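/- Let $$A(x,y,z)=\frac{1}{(2-y)(2-z)}\cdot\frac{1+\dfrac{xz^2}{1-2xz(1+yz)}+\dfrac{xy^2}{1-2xy(1+yz)}}{1-x(1+yz)^2-\dfrac{xyz}{1-2xz(1+yz)}-\dfrac{xyz}{1-2xy(1+yz)}},\qquad F(x,y,z)=\frac{A(x,y,z)}{(1-y)(1-z)},$$ expanded as formal power series in $x,y,z$ over $\mathbb R$, and let $[x^iy^jz^k]$ denote coefficient extraction. Then, as $n\to\infty$, $$\frac1{8^n}[x^ny^{n+1}z^{n+1}]\,F(x,y,z)=\frac14+\frac1{2\sqrt{\pi}}\frac1{\sqrt n}+\frac1{4\pi}\frac1n+O(n^{-3/2})$$ and $$\frac1{8^n}[x^ny^nz^n]\,F(x,y,z)=\frac14-\frac1{2\sqrt{\pi}}\frac1{\sqrt n}+\frac1{4\pi}\frac1n+O(n^{-3/2}).$$ These coefficients are second moments, as follows. Let $s(n)$ be the sum of the binary digits of $n\ge 0$. For all integers $t\ge0$ and $k\in\mathbb Z$ the asymptotic densities $\delta(k,t)$ of $\{n\ge0:s(n+t)-s(n)=k\}$, $c_t$ of $\{n\ge0:s(n+t)\ge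 s(n)\}$ and $\tilde c_t$ of $\{n\ge0:s(n+t)>s(n)\}$ exist; for all integers $\lambda,j,k\ge0$, $$[x^\lambda y^jz^k]\,A(x,y,z)=4^\lambda\sum_{2^\lambda\le t<2^{\lambda+1}}\delta(\lambda+1-j,t)\,\delta(\lambda+1-k,t);$$ and for all integers $\lambda\ge0$, $$\frac1{2^\lambda}\sum_{2^\lambda\le t<2^{\lambda+1}}c_t^2=\frac1{8^\lambda}[x^\lambda y^{\lambda+1}z^{\lambda+1}]\,F(x,y,z),\qquad \frac1{2^\lambda}\sum_{2^\lambda\le t<2^{\lambda+1}}\tilde c_t^2=\frac1{8^\lambda}[x^\lambda y^{\lambda}z^{\lambda}]\,F(x,y,z).$$ -/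

import Mathlib

open Filter Topology Asymptotics

noncomputable section

namespace Cusick

/-- The binary sum-of-digits function. -/
def s (n : ℕ) : ℕ := (Nat.digits 2 n).sum

/-- The set `S ⊆ ℕ` possesses the asymptotic density `d`. -/
def HasDensity (S : Set ℕ) (d : ℝ) : Prop :=
  Tendsto (fun N : ℕ => ((S ∩ Set.Iio N).ncard : ℝ) / (N : ℝ)) atTop (𝓝 d)

/-- The asymptotic density of `S ⊆ ℕ`; meaningful when `S` possesses one. -/
def dens (S : Set ℕ) : ℝ :=
  limUnder atTop (fun N : ℕ => ((S ∩ Set.Iio N).ncard : ℝ) / (N : ℝ))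

/-- `B(k,t) = {n : s(n+t) - s(n) = k}`. -/
def B (k : ℤ) (t : ℕ) : Set ℕ := {n | (s (n + t) : ℤ) - (s n : ℤ) = k}

/-- `δ(k,t)`, the asymptotic density of `B(k,t)`. -/
def δ (k : ℤ) (t : ℕ) : ℝ := dens (B k t)

/-- `c_t`, the asymptotic density of `{n : s(n+t) ≥ s(n)}`. -/
def c (t : ℕ) : ℝ := dens {n | s n ≤ s (n + t)}

/-- `c̃_t`, the asymptotic density of `{n : s(n+t) > s(n)}`. -/
def cTilde (t : ℕ) : ℝ := dens {n | s n < s (n + t)}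

/-- Formal power series in the three variables `x, y, z` over `ℝ`. -/
abbrev Series3 : Type := MvPowerSeries (Fin 3) ℝ

def x : Series3 := MvPowerSeries.X 0
def y : Series3 := MvPowerSeries.X 1
def z : Series3 := MvPowerSeries.X 2

/-- `[x^i y^j z^k] P`. -/
def coeff3 (i j k : ℕ) (P : Series3) : ℝ :=
  MvPowerSeries.coeff (Finsupp.single 0 i + Finsupp.single 1 j + Finsupp.single 2 k) P

/-- The numerator `1 + xz²/(1-2xz(1+yz)) + xy²/(1-2xy(1+yz))`.

Here and below `⁻¹` is only applied to power series with nonzero constant term,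
where it is the multiplicative inverse. -/
def numer : Series3 :=
  1 + x * z ^ 2 * (1 - 2 * x * z * (1 + y * z))⁻¹
    + x * y ^ 2 * (1 - 2 * x * y * (1 + y * z))⁻¹

/-- The denominator `1 - x(1+yz)² - xyz/(1-2xz(1+yz)) - xyz/(1-2xy(1+yz))`. -/
def H : Series3 :=
  1 - x * (1 + y * z) ^ 2
    - x * y * z * (1 - 2 * x * z * (1 + y * z))⁻¹
    - x * y * z * (1 - 2 * x * y * (1 + y * z))⁻¹

/-- The power series expansion of the rational function
`A = numer / ((2-y) (2-z) H)`. -/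
def A : Series3 := (2 - y)⁻¹ * (2 - z)⁻¹ * numer * H⁻¹

/-- `F = A / ((1-y)(1-z))`. -/
def F : Series3 := A * ((1 - y) * (1 - z))⁻¹

end Cusick

end

open Filter Topology Asymptotics

noncomputable section

namespace Cusick

/-! ### Asymptotic densities -/

/-! Splitting n by parity gives δ(k,2t) = δ(k,t) and δ(k,2t+1) = (δ(k-1,t) + δ(k+1,t+1))/2, and the
same for the tails `tailDens`. Everything rests on these rules; existence of the densities comes out
of the same induction.

Generating function. Over a dyadic block, the correlations of δ(·,t) with itself and with δ(·,t+1)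
satisfy a closed linear recursion in the level. It becomes three linear equations for three series
(`corrSer_diag`, `corrSer_right`, `corrSer_left`), and elimination gives `A` (`corrSer_eq_A`).
Dividing by (1-y)(1-z) turns point densities into tails, so the two diagonals of `F` are the block
means of c_t² and c̃_t² (`coeff3_F_div`).

Asymptotics. The second moments are estimated probabilistically, as squared mean plus variance,
without singularity analysis of `F`. Write γ_1 = `charFnOne θ`, p_t = `charFn θ t`, h = `haverSin θ`
= sin²(θ/2), ρ = `decayRate θ`. The characteristic function of s(n+t)-s(n) is γ_1 p_t, and a tail is
1/2 plus an integral over [0,π] of its real part and of its imaginary part times cot(θ/2)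
(`tailDens_eq_tailFunctional`).

Mean: p_t has block mean (1-h)^l = cos^{2l}(θ/2). The remaining kernel is σ + O(h), with σ = 1 for
c_t and σ = -1 for c̃_t. Hence the mean is 1/2 + (σ/2) C(2l,l)/4^l + O(l^{-3/2}), and Wallis'
product gives C(2l,l)/4^l = 1/√(πl) + O(l^{-3/2}).

Variance: recursions for five quadratic moments of (p_t, p_{t+1}) bound the variance of Re p_t by
O(l h² ρ^l) and the mean of (Im p_t)² by O(l h³ ρ^l) (`reVar_le`, `imSq_le`). The extra h pays for
the squared cotangent. Cauchy–Schwarz and ∫ h² ρ^l = O(l^{-5/2}) give variance O(l^{-3/2})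
(`exists_variance_le`). The square of 1/2 + σ/(2√(πl)) is then the whole expansion. -/

lemma s_two_mul (n : ℕ) : s (2 * n) = s n := by
  rcases Nat.eq_zero_or_pos n with rfl | hn
  · simp
  · simp [s, Nat.digits_of_two_le_of_pos le_rfl (by omega : 0 < 2 * n)]

lemma s_two_mul_add_one (n : ℕ) : s (2 * n + 1) = s n + 1 := by
  simp [s, Nat.add_comm, Nat.add_div]

lemma s_succ_le (n : ℕ) : s (n + 1) ≤ s n + 1 := by
  induction n using Nat.strong_induction_on with
  | _ n ih =>
    rcases Nat.even_or_odd' n with ⟨a, rfl | rfl⟩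
    · rw [s_two_mul_add_one, s_two_mul]
    · rw [show 2 * a + 1 + 1 = 2 * (a + 1) by ring, s_two_mul, s_two_mul_add_one]
      have := ih a (by omega)
      omega

lemma s_add_le (n t : ℕ) : s (n + t) ≤ s n + s t := by
  induction n using Nat.strong_induction_on generalizing t with
  | _ n ih =>
    rcases Nat.eq_zero_or_pos n with rfl | hn
    · simp
    rcases Nat.even_or_odd' n with ⟨a, rfl | rfl⟩ <;>
      rcases Nat.even_or_odd' t with ⟨b, rfl | rfl⟩ <;> have := ih a (by omega) b
    · rw [← mul_add, s_two_mul, s_two_mul, s_two_mul]; exact this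
    · rw [← add_assoc, ← mul_add, s_two_mul_add_one, s_two_mul, s_two_mul_add_one]; omega
    · rw [show 2 * a + 1 + 2 * b = 2 * (a + b) + 1 by ring, s_two_mul, s_two_mul_add_one,
        s_two_mul_add_one]; omega
    · rw [show 2 * a + 1 + (2 * b + 1) = 2 * (a + b + 1) by ring, s_two_mul, s_two_mul_add_one,
        s_two_mul_add_one]
      have := s_succ_le (a + b)
      omega

lemma s_le_of_lt (l t : ℕ) (ht : t < 2 ^ l) : s t ≤ l := by
  induction l generalizing t with
  | zero =>
    obtain rfl : t = 0 := by simpa using ht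
    simp [s]
  | succ l ih =>
    rw [pow_succ] at ht
    rcases Nat.even_or_odd' t with ⟨b, rfl | rfl⟩ <;> have := ih b (by omega)
    · rw [s_two_mul]; omega
    · rw [s_two_mul_add_one]; omega

lemma s_two_pow (l : ℕ) : s (2 ^ l) = 1 := by
  induction l with
  | zero => simp [s]
  | succ l ih => rw [pow_succ', s_two_mul, ih]

lemma s_le_of_le (l t : ℕ) (ht : t ≤ 2 ^ (l + 1)) : s t ≤ l + 1 := by
  rcases ht.lt_or_eq with h | rfl
  · exact s_le_of_lt _ _ h
  · rw [s_two_pow]; omega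

open Classical in
lemma ncard_inter_Iio (S : Set ℕ) (N : ℕ) : (S ∩ Set.Iio N).ncard = Nat.count (· ∈ S) N := by
  rw [Nat.count_eq_card_filter_range, ← Set.ncard_coe_finset]
  congr 1
  ext n
  simp [and_comm]

lemma ncard_inter_Iio_eq_even_add_odd (S : Set ℕ) (N : ℕ) :
    (S ∩ Set.Iio N).ncard = ({n | 2 * n ∈ S} ∩ Set.Iio ((N + 1) / 2)).ncard
      + ({n | 2 * n + 1 ∈ S} ∩ Set.Iio (N / 2)).ncard := by
  classical
  simp only [ncard_inter_Iio]
  induction N with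
  | zero => simp
  | succ N ih =>
    rw [Nat.count_succ, ih]
    rcases Nat.even_or_odd' N with ⟨a, rfl | rfl⟩
    · rw [show (2 * a + 1 + 1) / 2 = a + 1 by omega, show (2 * a + 1) / 2 = a by omega,
        show 2 * a / 2 = a by omega, Nat.count_succ]
      simp only [Set.mem_ofPred_eq]; ring
    · rw [show (2 * a + 1 + 1 + 1) / 2 = a + 1 by omega, show (2 * a + 1 + 1) / 2 = a + 1 by omega,
        show (2 * a + 1) / 2 = a by omega, Nat.count_succ (fun x => x ∈ {n | 2 * n + 1 ∈ S})]
      simp only [Set.mem_ofPred_eq]; ring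

lemma tendsto_half_ratio {k : ℕ → ℕ} (hk : ∀ N, N ≤ 2 * k N + 1 ∧ 2 * k N ≤ N + 1) :
    Tendsto (fun N : ℕ => (k N : ℝ) / (N : ℝ)) atTop (𝓝 (1 / 2)) := by
  have h : Tendsto (fun N : ℕ => (1 : ℝ) / (N : ℝ)) atTop (𝓝 0) :=
    tendsto_one_div_atTop_nhds_zero_nat
  have h1 : Tendsto (fun N : ℕ => (1 : ℝ) / 2 - 1 / (N : ℝ)) atTop (𝓝 (1 / 2)) := by
    simpa only [sub_zero] using h.const_sub (1 / 2)
  have h2 : Tendsto (fun N : ℕ => (1 : ℝ) / 2 + 1 / (N : ℝ)) atTop (𝓝 (1 / 2)) := by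
    simpa only [add_zero] using h.const_add (1 / 2)
  refine tendsto_of_tendsto_of_tendsto_of_le_of_le' h1 h2 ?_ ?_ <;>
    filter_upwards [eventually_gt_atTop 0] with N hN
  · have hN' : (0 : ℝ) < N := by exact_mod_cast hN
    have : (N : ℝ) ≤ 2 * k N + 1 := by exact_mod_cast (hk N).1
    rw [div_sub_div _ _ (by norm_num) hN'.ne', div_le_div_iff₀ (by positivity) hN']
    nlinarith
  · have hN' : (0 : ℝ) < N := by exact_mod_cast hN
    have : 2 * (k N : ℝ) ≤ N + 1 := by exact_mod_cast (hk N).2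
    rw [div_add_div _ _ (by norm_num) hN'.ne', div_le_div_iff₀ hN' (by positivity)]
    nlinarith

/-- The hypothesis on `k` covers both ⌈N/2⌉ and ⌊N/2⌋, the numbers of even and odd integers below N.
-/
lemma HasDensity.comp_half {S : Set ℕ} {d : ℝ} (h : HasDensity S d) {k : ℕ → ℕ}
    (hk : ∀ N, N ≤ 2 * k N + 1 ∧ 2 * k N ≤ N + 1) :
    Tendsto (fun N : ℕ => ((S ∩ Set.Iio (k N)).ncard : ℝ) / (N : ℝ)) atTop (𝓝 (d / 2)) := by
  have hk' : Tendsto k atTop atTop := by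
    refine tendsto_atTop.2 fun b => ?_
    filter_upwards [eventually_ge_atTop (2 * b + 1)] with N hN
    have := (hk N).1
    omega
  have := (Tendsto.comp h hk').mul (tendsto_half_ratio hk)
  rw [show d / 2 = d * (1 / 2) by ring]
  refine this.congr' ?_
  filter_upwards [eventually_gt_atTop 1] with N hN
  have h1 : (k N : ℝ) ≠ 0 := by
    have := (hk N).1
    exact_mod_cast (by omega : k N ≠ 0)
  simp only [Function.comp]
  field_simp

lemma HasDensity.of_even_odd {S : Set ℕ} {d₀ d₁ : ℝ} (h₀ : HasDensity {n | 2 * n ∈ S} d₀)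
    (h₁ : HasDensity {n | 2 * n + 1 ∈ S} d₁) : HasDensity S ((d₀ + d₁) / 2) := by
  have := (h₀.comp_half (k := fun N => (N + 1) / 2) (fun N => by omega)).add
    (h₁.comp_half (k := fun N => N / 2) (fun N => by omega))
  rw [← add_div] at this
  refine this.congr fun N => ?_
  rw [ncard_inter_Iio_eq_even_add_odd S N, ← add_div]
  push_cast
  rfl

lemma HasDensity.union {S T : Set ℕ} {d e : ℝ} (hS : HasDensity S d) (hT : HasDensity T e)
    (hST : Disjoint S T) : HasDensity (S ∪ T) (d + e) := by
  refine (Tendsto.add hS hT).congr fun N => ?_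
  rw [← add_div, Set.union_inter_distrib_right, Set.ncard_union_eq]
  · push_cast; ring
  · exact hST.mono Set.inter_subset_left Set.inter_subset_left

lemma hasDensity_empty : HasDensity ∅ 0 := by
  simp [HasDensity]

lemma hasDensity_univ : HasDensity Set.univ 1 := by
  refine tendsto_const_nhds.congr' ?_
  filter_upwards [eventually_gt_atTop 0] with N hN
  have : (N : ℝ) ≠ 0 := by exact_mod_cast hN.ne'
  rw [ncard_inter_Iio, Nat.count_eq_card_filter_range]
  simp [this]

lemma HasDensity.unique {S : Set ℕ} {d e : ℝ} (hS : HasDensity S d) (hT : HasDensity S e) :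
    d = e := tendsto_nhds_unique hS hT

lemma HasDensity.dens_eq {S : Set ℕ} {d : ℝ} (hS : HasDensity S d) : dens S = d :=
  Tendsto.limUnder_eq hS

lemma HasDensity.hasDensity_dens {S : Set ℕ} {d : ℝ} (hS : HasDensity S d) :
    HasDensity S (dens S) := by rwa [hS.dens_eq]

/-! ### The digit difference and its tails -/

lemma even_mem_B_two_mul (k : ℤ) (t : ℕ) : {n | 2 * n ∈ B k (2 * t)} = B k t := by
  ext n; simp [B, ← mul_add, s_two_mul]

lemma odd_mem_B_two_mul (k : ℤ) (t : ℕ) : {n | 2 * n + 1 ∈ B k (2 * t)} = B k t := by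
  ext n
  simp [B, show 2 * n + 1 + 2 * t = 2 * (n + t) + 1 by ring, s_two_mul_add_one]

lemma even_mem_B_two_mul_add_one (k : ℤ) (t : ℕ) :
    {n | 2 * n ∈ B k (2 * t + 1)} = B (k - 1) t := by
  ext n
  simp only [B, Set.mem_ofPred_eq, show 2 * n + (2 * t + 1) = 2 * (n + t) + 1 by ring, s_two_mul,
    s_two_mul_add_one]
  push_cast
  omega

lemma odd_mem_B_two_mul_add_one (k : ℤ) (t : ℕ) :
    {n | 2 * n + 1 ∈ B k (2 * t + 1)} = B (k + 1) (t + 1) := by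
  ext n
  simp only [B, Set.mem_ofPred_eq, show 2 * n + 1 + (2 * t + 1) = 2 * (n + (t + 1)) by ring,
    s_two_mul, s_two_mul_add_one]
  push_cast
  omega

lemma B_eq_empty {k : ℤ} {t : ℕ} (h : (s t : ℤ) < k) : B k t = ∅ := by
  ext n
  have := s_add_le n t
  simp only [B, Set.mem_ofPred_eq, Set.mem_empty_iff_false, iff_false]
  omega

lemma exists_hasDensity_B_zero (k : ℤ) : ∃ d, HasDensity (B k 0) d := by
  by_cases hk : k = 0
  · exact ⟨1, by convert hasDensity_univ; ext n; simp [B, hk]⟩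
  · exact ⟨0, by convert hasDensity_empty; ext n; simp [B, Ne.symm hk]⟩

/-- The odd rule for 1 = 2·0+1 refers back to t = 1, so induction on t fails here. It raises k by
one, however, and B(2,1) is empty: the induction runs downwards in k from 2. -/
lemma exists_hasDensity_B_one (k : ℤ) : ∃ d, HasDensity (B k 1) d := by
  have key : ∀ j : ℕ, ∃ d, HasDensity (B (2 - j) 1) d := by
    intro j
    induction j with
    | zero => exact ⟨0, by rw [B_eq_empty (by simp [s])]; exact hasDensity_empty⟩
    | succ j ih =>
      obtain ⟨d, hd⟩ := ih
      obtain ⟨e, he⟩ := exists_hasDensity_B_zero (2 - (j + 1 : ℕ) - 1)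
      refine ⟨_, HasDensity.of_even_odd (d₀ := e) (d₁ := d) ?_ ?_⟩
      · rw [even_mem_B_two_mul_add_one _ 0]; exact he
      · rw [odd_mem_B_two_mul_add_one _ 0]; convert hd using 2; push_cast; ring
  by_cases hk : 2 ≤ k
  · exact ⟨0, by rw [B_eq_empty (by simp [s]; omega)]; exact hasDensity_empty⟩
  · have := key (2 - k).toNat
    rwa [show (2 : ℤ) - (2 - k).toNat = k by omega] at this

lemma exists_hasDensity_B (k : ℤ) (t : ℕ) : ∃ d, HasDensity (B k t) d := by
  induction t using Nat.strong_induction_on generalizing k with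
  | _ t ih =>
    rcases Nat.even_or_odd' t with ⟨a, rfl | rfl⟩
    · rcases Nat.eq_zero_or_pos a with rfl | ha
      · exact exists_hasDensity_B_zero k
      · obtain ⟨d, hd⟩ := ih a (by omega) k
        exact ⟨_, HasDensity.of_even_odd (by rwa [even_mem_B_two_mul])
          (by rwa [odd_mem_B_two_mul])⟩
    · rcases Nat.eq_zero_or_pos a with rfl | ha
      · exact exists_hasDensity_B_one k
      · obtain ⟨d, hd⟩ := ih a (by omega) (k - 1)
        obtain ⟨e, he⟩ := ih (a + 1) (by omega) (k + 1)
        exact ⟨_, HasDensity.of_even_odd (by rwa [even_mem_B_two_mul_add_one])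
          (by rwa [odd_mem_B_two_mul_add_one])⟩

lemma hasDensity_B (k : ℤ) (t : ℕ) : HasDensity (B k t) (δ k t) :=
  (exists_hasDensity_B k t).choose_spec.hasDensity_dens

lemma δ_two_mul (k : ℤ) (t : ℕ) : δ k (2 * t) = δ k t := by
  refine (hasDensity_B k (2 * t)).unique ?_
  rw [← add_self_div_two (δ k t)]
  exact HasDensity.of_even_odd (by rw [even_mem_B_two_mul]; exact hasDensity_B _ _)
    (by rw [odd_mem_B_two_mul]; exact hasDensity_B _ _)

lemma δ_two_mul_add_one (k : ℤ) (t : ℕ) :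
    δ k (2 * t + 1) = (δ (k - 1) t + δ (k + 1) (t + 1)) / 2 :=
  (hasDensity_B k (2 * t + 1)).unique
    (HasDensity.of_even_odd (by rw [even_mem_B_two_mul_add_one]; exact hasDensity_B _ _)
      (by rw [odd_mem_B_two_mul_add_one]; exact hasDensity_B _ _))

lemma δ_eq_zero {k : ℤ} {t : ℕ} (h : (s t : ℤ) < k) : δ k t = 0 := by
  rw [δ, B_eq_empty h, hasDensity_empty.dens_eq]

lemma δ_zero (k : ℤ) : δ k 0 = if k = 0 then 1 else 0 := by
  split_ifs with hk
  · exact (hasDensity_B k 0).unique (by convert hasDensity_univ; ext n; simp [B, hk])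
  · exact (hasDensity_B k 0).unique (by convert hasDensity_empty; ext n; simp [B, Ne.symm hk])

/-- The set of `n` with `s(n+t) - s(n) ≥ m`. -/
def tail (m : ℤ) (t : ℕ) : Set ℕ := {n | m ≤ (s (n + t) : ℤ) - (s n : ℤ)}

/-- The asymptotic density of `tail m t`. -/
def tailDens (m : ℤ) (t : ℕ) : ℝ := dens (tail m t)

lemma tail_eq_empty {m : ℤ} {t : ℕ} (h : (s t : ℤ) < m) : tail m t = ∅ := by
  ext n
  have := s_add_le n t
  simp only [tail, Set.mem_ofPred_eq, Set.mem_empty_iff_false, iff_false]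
  omega

lemma tail_eq_union (m : ℤ) (t : ℕ) : tail m t = tail (m + 1) t ∪ B m t := by
  ext n
  simp only [tail, B, Set.mem_ofPred_eq, Set.mem_union]
  omega

lemma disjoint_tail_B (m : ℤ) (t : ℕ) : Disjoint (tail (m + 1) t) (B m t) := by
  refine Set.disjoint_left.2 fun n h h' => ?_
  simp only [tail, B, Set.mem_ofPred_eq] at h h'
  omega

/-- Density is only finitely additive, but B(k,t) is empty for k > s(t), so a tail is a finite
disjoint union of sets B(k,t). -/
lemma hasDensity_tail (m : ℤ) (t : ℕ) : HasDensity (tail m t) (tailDens m t) := by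
  suffices ∃ d, HasDensity (tail m t) d from this.choose_spec.hasDensity_dens
  have key : ∀ j : ℕ, ∃ d, HasDensity (tail (s t + 1 - j) t) d := by
    intro j
    induction j with
    | zero => exact ⟨0, by rw [tail_eq_empty (by simp)]; exact hasDensity_empty⟩
    | succ j ih =>
      obtain ⟨d, hd⟩ := ih
      rw [tail_eq_union]
      refine ⟨_, HasDensity.union (d := d) ?_ (hasDensity_B _ _) (disjoint_tail_B _ _)⟩
      convert hd using 2
      push_cast
      ring
  by_cases hm : (s t : ℤ) + 1 ≤ m
  · exact ⟨0, by rw [tail_eq_empty (by omega)]; exact hasDensity_empty⟩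
  · have := key (s t + 1 - m).toNat
    rwa [show (s t : ℤ) + 1 - (s t + 1 - m).toNat = m by omega] at this

lemma tailDens_eq_zero {m : ℤ} {t : ℕ} (h : (s t : ℤ) < m) : tailDens m t = 0 := by
  rw [tailDens, tail_eq_empty h, hasDensity_empty.dens_eq]

lemma tailDens_eq_add (m : ℤ) (t : ℕ) : tailDens m t = tailDens (m + 1) t + δ m t := by
  refine (hasDensity_tail m t).unique ?_
  rw [tail_eq_union]
  exact (hasDensity_tail _ _).union (hasDensity_B _ _) (disjoint_tail_B _ _)

lemma tailDens_zero (m : ℤ) : tailDens m 0 = if m ≤ 0 then 1 else 0 := by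
  split_ifs with hm
  · exact (hasDensity_tail m 0).unique (by convert hasDensity_univ; ext n; simp [tail, hm])
  · exact (hasDensity_tail m 0).unique (by convert hasDensity_empty; ext n; simp [tail]; omega)

lemma tailDens_two_mul (m : ℤ) (t : ℕ) : tailDens m (2 * t) = tailDens m t := by
  have h₀ : {n | 2 * n ∈ tail m (2 * t)} = tail m t := by
    ext n; simp [tail, ← mul_add, s_two_mul]
  have h₁ : {n | 2 * n + 1 ∈ tail m (2 * t)} = tail m t := by
    ext n
    simp [tail, show 2 * n + 1 + 2 * t = 2 * (n + t) + 1 by ring, s_two_mul_add_one]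
  refine (hasDensity_tail m (2 * t)).unique ?_
  rw [← add_self_div_two (tailDens m t)]
  exact HasDensity.of_even_odd (by rw [h₀]; exact hasDensity_tail _ _)
    (by rw [h₁]; exact hasDensity_tail _ _)

lemma tailDens_two_mul_add_one (m : ℤ) (t : ℕ) :
    tailDens m (2 * t + 1) = (tailDens (m - 1) t + tailDens (m + 1) (t + 1)) / 2 := by
  have h₀ : {n | 2 * n ∈ tail m (2 * t + 1)} = tail (m - 1) t := by
    ext n
    simp only [tail, Set.mem_ofPred_eq, show 2 * n + (2 * t + 1) = 2 * (n + t) + 1 by ring,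
      s_two_mul, s_two_mul_add_one]
    push_cast
    omega
  have h₁ : {n | 2 * n + 1 ∈ tail m (2 * t + 1)} = tail (m + 1) (t + 1) := by
    ext n
    simp only [tail, Set.mem_ofPred_eq, show 2 * n + 1 + (2 * t + 1) = 2 * (n + (t + 1)) by ring,
      s_two_mul, s_two_mul_add_one]
    push_cast
    omega
  exact (hasDensity_tail m (2 * t + 1)).unique
    (HasDensity.of_even_odd (by rw [h₀]; exact hasDensity_tail _ _)
      (by rw [h₁]; exact hasDensity_tail _ _))

lemma tailDens_mem_Icc (m : ℤ) (t : ℕ) : tailDens m t ∈ Set.Icc (0 : ℝ) 1 := by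
  refine isClosed_Icc.mem_of_tendsto (hasDensity_tail m t) (Eventually.of_forall fun N => ?_)
  refine ⟨by positivity, div_le_one_of_le₀ ?_ (by positivity)⟩
  have := Set.ncard_le_ncard (Set.inter_subset_right (s := tail m t) (t := Set.Iio N))
    (Set.finite_Iio N)
  have h : (Set.Iio N).ncard = N := by simp [Set.ncard_eq_toFinset_card']
  exact_mod_cast this.trans h.le

lemma setOf_le_eq_tail (t : ℕ) : {n | s n ≤ s (n + t)} = tail 0 t := by
  ext n; simp [tail]

lemma setOf_lt_eq_tail (t : ℕ) : {n | s n < s (n + t)} = tail 1 t := by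
  ext n
  simp only [tail, Set.mem_ofPred_eq]
  omega

lemma c_eq_tailDens (t : ℕ) : c t = tailDens 0 t := by rw [c, setOf_le_eq_tail, tailDens]

lemma cTilde_eq_tailDens (t : ℕ) : cTilde t = tailDens 1 t := by
  rw [cTilde, setOf_lt_eq_tail, tailDens]

/-! ### Sums over dyadic blocks -/

lemma sum_block_succ {M : Type*} [AddCommMonoid M] (G : ℕ → M) (l : ℕ) :
    ∑ t ∈ Finset.Ico (2 ^ (l + 1)) (2 ^ (l + 1 + 1)), G t
      = ∑ t ∈ Finset.Ico (2 ^ l) (2 ^ (l + 1)), (G (2 * t) + G (2 * t + 1)) := by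
  have key : ∀ a b : ℕ, a ≤ b → ∑ t ∈ Finset.Ico (2 * a) (2 * b), G t
      = ∑ t ∈ Finset.Ico a b, (G (2 * t) + G (2 * t + 1)) := by
    intro a b hab
    induction b, hab using Nat.le_induction with
    | base => simp
    | succ b hb ih =>
      rw [Finset.sum_Ico_succ_top hb, ← ih, show 2 * (b + 1) = 2 * b + 1 + 1 by ring,
        Finset.sum_Ico_succ_top (by omega), Finset.sum_Ico_succ_top (by omega), add_assoc]
  rw [← key _ _ (Nat.pow_le_pow_right (by norm_num) (Nat.le_succ l)), ← pow_succ', ← pow_succ']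

/-- The difference telescopes to the two ends of the block, where functions invariant under doubling
agree. This is why no separate (t+1, t+1) correlation is needed. -/
lemma sum_block_shift {M : Type*} [AddCommGroup M] (G : ℕ → M) (l : ℕ)
    (hG : G (2 ^ (l + 1)) = G (2 ^ l)) :
    ∑ t ∈ Finset.Ico (2 ^ l) (2 ^ (l + 1)), G (t + 1)
      = ∑ t ∈ Finset.Ico (2 ^ l) (2 ^ (l + 1)), G t := by
  rw [← sub_eq_zero, ← Finset.sum_sub_distrib,
    Finset.sum_Ico_sub _ (Nat.pow_le_pow_right (by norm_num) (Nat.le_succ l)), hG, sub_self]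

lemma δ_two_pow (k : ℤ) (l : ℕ) : δ k (2 ^ l) = δ k 1 := by
  induction l with
  | zero => simp
  | succ l ih => rw [pow_succ', δ_two_mul, ih]

/-! ### Power series with coefficients indexed by integers -/

/-- The power series with coefficients `f i j k`. -/
def ser (f : ℤ → ℤ → ℤ → ℝ) : Series3 := fun e => f (e 0) (e 1) (e 2)

/-- Vanishing of `f` outside the nonnegative octant. -/
def OctantSupported (f : ℤ → ℤ → ℤ → ℝ) : Prop :=
  ∀ i j k, i < 0 ∨ j < 0 ∨ k < 0 → f i j k = 0

lemma coeff_ser (f : ℤ → ℤ → ℤ → ℝ) (e : Fin 3 →₀ ℕ) :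
    MvPowerSeries.coeff e (ser f) = f (e 0) (e 1) (e 2) := rfl

lemma coeff3_ser (f : ℤ → ℤ → ℤ → ℝ) (i j k : ℕ) : coeff3 i j k (ser f) = f i j k := by
  rw [coeff3, coeff_ser]
  simp [Finsupp.add_apply]

/-- Octant support makes the shifted coefficients vanish exactly where the monomial does not divide,
so multiplication is a plain shift of integer indices. -/
lemma monomial_mul_ser {f : ℤ → ℤ → ℤ → ℝ} (hf : OctantSupported f) (a b c : ℕ) :
    x ^ a * y ^ b * z ^ c * ser f = ser fun i j k => f (i - a) (j - b) (k - c) := by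
  ext e
  simp only [x, y, z, MvPowerSeries.X_pow_eq, MvPowerSeries.monomial_mul_monomial, one_mul]
  rw [MvPowerSeries.coeff_monomial_mul, coeff_ser]
  split_ifs with h
  · have h0 := h 0
    have h1 := h 1
    have h2 := h 2
    simp [Finsupp.add_apply] at h0 h1 h2
    rw [coeff_ser]
    simp [Nat.cast_sub h0, Nat.cast_sub h1,
      Nat.cast_sub h2]
  · refine (hf _ _ _ ?_).symm
    contrapose! h
    intro i
    fin_cases i <;> simp [Finsupp.add_apply] <;> omega

/-- `4^l ∑ₜ f(l+1-j, t+a) f(l+1-k, t+b)`, the sum being over the dyadic block `[2^l, 2^(l+1))`. -/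
def blockCorr (f : ℤ → ℕ → ℝ) (a b : ℕ) (i j k : ℤ) : ℝ :=
  if i < 0 then 0 else
    4 ^ i.toNat * ∑ t ∈ Finset.Ico (2 ^ i.toNat) (2 ^ (i.toNat + 1)),
      f (i + 1 - j) (t + a) * f (i + 1 - k) (t + b)

lemma blockCorr_natCast (f : ℤ → ℕ → ℝ) (a b l : ℕ) (j k : ℤ) :
    blockCorr f a b l j k = 4 ^ l * ∑ t ∈ Finset.Ico (2 ^ l) (2 ^ (l + 1)),
      f (l + 1 - j) (t + a) * f (l + 1 - k) (t + b) := by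
  simp [blockCorr]

/-- Every t+a with t in the block and a ≤ 1 has digit sum at most l+1; the new endpoint 2^(l+1) has
digit sum 1. Hence the offset l+1-j: negative j would ask for a digit gain above s(t+a). -/
lemma octantSupported_blockCorr {f : ℤ → ℕ → ℝ} (hf : ∀ (k : ℤ) (t : ℕ), (s t : ℤ) < k → f k t = 0)
    {a b : ℕ} (ha : a ≤ 1) (hb : b ≤ 1) : OctantSupported (blockCorr f a b) := by
  intro i j k h
  unfold blockCorr
  split_ifs with hi
  · rfl
  · have key : ∀ t ∈ Finset.Ico (2 ^ i.toNat) (2 ^ (i.toNat + 1)), ∀ a ≤ 1, ∀ j < 0,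
        f (i + 1 - j) (t + a) = 0 := by
      intro t ht a ha j hj
      have := s_le_of_le i.toNat (t + a) (by simp at ht; omega)
      exact hf _ _ (by omega)
    rw [Finset.sum_eq_zero, mul_zero]
    intro t ht
    rcases h with h | h | h
    · exact absurd h hi
    · rw [key t ht a ha j h, zero_mul]
    · rw [key t ht b hb k h, mul_zero]

/-- The coefficients of `1 / ((2-y)(2-z))`. -/
def initCoeff (i j k : ℤ) : ℝ := if i = 0 then δ (1 - j) 1 * δ (1 - k) 1 else 0

lemma octantSupported_initCoeff : OctantSupported initCoeff := by
  have h1 : ∀ j < 0, δ (1 - j) 1 = 0 := fun j hj => δ_eq_zero (by simp [s]; omega)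
  intro i j k h
  unfold initCoeff
  split_ifs with hi
  · rcases h with h | h | h
    · omega
    · rw [h1 j h, zero_mul]
    · rw [h1 k h, mul_zero]
  · rfl

lemma two_mul_δ_one (k : ℤ) : 2 * δ k 1 = (if k = 1 then 1 else 0) + δ (k + 1) 1 := by
  have := δ_two_mul_add_one k 0
  rw [δ_zero] at this
  simp only [mul_zero, zero_add] at this
  simp only [show (k - 1 = 0) ↔ k = 1 by omega] at this
  rw [this]
  ring

/-- By `two_mul_δ_one`, the series Σ_j δ(1-j,1) y^j is inverted by 2-y; `initCoeff` is a product of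
two such sequences. -/
lemma sub_mul_sub_mul_ser_initCoeff : (2 - y) * (2 - z) * ser initCoeff = 1 := by
  have hs := octantSupported_initCoeff
  have : (2 - y) * (2 - z) * ser initCoeff
      = 4 • ser initCoeff - 2 • (x ^ 0 * y ^ 1 * z ^ 0 * ser initCoeff)
        - 2 • (x ^ 0 * y ^ 0 * z ^ 1 * ser initCoeff) + x ^ 0 * y ^ 1 * z ^ 1 * ser initCoeff := by
    ring
  rw [this]
  simp only [monomial_mul_ser hs]
  ext e
  simp only [map_add, map_sub, map_nsmul, coeff_ser, initCoeff]
  have h1 := two_mul_δ_one (1 - e 1)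
  have h2 := two_mul_δ_one (1 - e 2)
  rw [show (1 : ℤ) - e 1 + 1 = 1 - (e 1 - (1 : ℕ)) by push_cast; ring] at h1
  rw [show (1 : ℤ) - e 2 + 1 = 1 - (e 2 - (1 : ℕ)) by push_cast; ring] at h2
  have h3 : MvPowerSeries.coeff e (1 : Series3)
      = if (e 0 : ℤ) = 0 then (if (1 : ℤ) - e 1 = 1 then 1 else 0)
        * (if (1 : ℤ) - e 2 = 1 then 1 else 0) else 0 := by
    rw [MvPowerSeries.coeff_one]
    have : e = 0 ↔ (e 0 : ℤ) = 0 ∧ (1 : ℤ) - e 1 = 1 ∧ (1 : ℤ) - e 2 = 1 := by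
      constructor
      · rintro rfl; simp
      · rintro ⟨h0, h1, h2⟩
        ext i
        fin_cases i <;> simp <;> omega
    by_cases h0 : (e 0 : ℤ) = 0 <;> by_cases h1 : (1 : ℤ) - e 1 = 1 <;>
      by_cases h2 : (1 : ℤ) - e 2 = 1 <;> simp only [this, h0, h1, h2] <;> simp
  rw [h3]
  simp only [Nat.cast_zero, sub_zero, nsmul_eq_mul]
  by_cases h0 : (e 0 : ℤ) = 0
  · simp only [h0, if_true]
    push_cast at h1 h2 ⊢
    linear_combination (2 * δ (1 - (e 2 : ℤ)) 1 - δ (1 - ((e 2 : ℤ) - 1)) 1) * h1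
      + (if (1 : ℤ) - e 1 = 1 then (1 : ℝ) else 0) * h2
  · simp only [h0, if_false]
    ring

/-! ### Level recurrences for the correlations and the linear system that gives `A`. -/

section Recurrences

variable (l : ℕ) (J K : ℤ)

/-- Even arguments reproduce δ(J,t)δ(K,t). Odd ones give a product of two averages, whose (t+1, t+1)
term is moved back to t by `sum_block_shift`. The 4 clears the two halves and accounts for the
weight 4^l in `blockCorr`. -/
lemma four_mul_blockSum_diag :
    4 * ∑ t ∈ Finset.Ico (2 ^ (l + 1)) (2 ^ (l + 1 + 1)), δ J t * δ K t
      = ∑ t ∈ Finset.Ico (2 ^ l) (2 ^ (l + 1)),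
        (δ (J - 1) t * δ (K - 1) t + 4 * (δ J t * δ K t) + δ (J + 1) t * δ (K + 1) t
          + δ (J - 1) t * δ (K + 1) (t + 1) + δ (K - 1) t * δ (J + 1) (t + 1)) := by
  have h := sum_block_shift (fun t => δ (J + 1) t * δ (K + 1) t) l (by simp only [δ_two_pow])
  simp only [Finset.sum_add_distrib, ← Finset.mul_sum] at h ⊢
  rw [← h, sum_block_succ]
  simp only [Finset.mul_sum, ← Finset.sum_add_distrib]
  refine Finset.sum_congr rfl fun t _ => ?_
  rw [δ_two_mul, δ_two_mul, δ_two_mul_add_one, δ_two_mul_add_one]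
  ring

lemma four_mul_blockSum_right :
    4 * ∑ t ∈ Finset.Ico (2 ^ (l + 1)) (2 ^ (l + 1 + 1)), δ J t * δ K (t + 1)
      = ∑ t ∈ Finset.Ico (2 ^ l) (2 ^ (l + 1)),
        (2 * (δ J t * δ (K - 1) t) + 2 * (δ (J + 1) t * δ K t)
          + 2 * (δ (J - 1) t * δ K (t + 1)) + 2 * (δ J t * δ (K + 1) (t + 1))) := by
  have h := sum_block_shift (fun t => δ (J + 1) t * δ K t) l (by simp only [δ_two_pow])
  simp only [Finset.sum_add_distrib, ← Finset.mul_sum] at h ⊢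
  rw [← h, sum_block_succ]
  simp only [Finset.mul_sum, ← Finset.sum_add_distrib]
  refine Finset.sum_congr rfl fun t _ => ?_
  rw [show 2 * t + 1 + 1 = 2 * (t + 1) by ring, δ_two_mul, δ_two_mul, δ_two_mul_add_one,
    δ_two_mul_add_one]
  ring

lemma blockSum_left (f : ℤ → ℕ → ℝ) :
    ∑ t ∈ Finset.Ico (2 ^ l) (2 ^ (l + 1)), f J (t + 1) * f K t
      = ∑ t ∈ Finset.Ico (2 ^ l) (2 ^ (l + 1)), f K t * f J (t + 1) :=
  Finset.sum_congr rfl fun _ _ => mul_comm _ _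

end Recurrences

lemma blockCorr_zero (a b : ℕ) (ha : a ≤ 1) (hb : b ≤ 1) (j k : ℤ) :
    blockCorr δ a b 0 j k = δ (1 - j) 1 * δ (1 - k) 1 := by
  have h := blockCorr_natCast δ a b 0 j k
  have h2 : ∀ k, δ k 2 = δ k 1 := fun k => δ_two_pow k 1
  rw [Nat.cast_zero] at h
  rw [h]
  interval_cases a <;> interval_cases b <;> simp [h2]

/-- The series of the correlations `δ(·,t+a) δ(·,t+b)`. -/
abbrev corrSer (a b : ℕ) : Series3 := ser (blockCorr δ a b)

lemma octantSupported_δ {a b : ℕ} (ha : a ≤ 1) (hb : b ≤ 1) :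
    OctantSupported (blockCorr δ a b) :=
  octantSupported_blockCorr (fun _ _ => δ_eq_zero) ha hb

lemma corrSer_diag : corrSer 0 0 = ser initCoeff
    + x * ((1 + y * z) ^ 2 + 2 * y * z) * corrSer 0 0 + x * z ^ 2 * corrSer 0 1
    + x * y ^ 2 * corrSer 1 0 := by
  have h00 := octantSupported_δ (a := 0) (b := 0) (by simp) (by simp)
  have h01 := octantSupported_δ (a := 0) (b := 1) (by simp) (by simp)
  have h10 := octantSupported_δ (a := 1) (b := 0) (by simp) (by simp)
  have : ser initCoeff
    + x * ((1 + y * z) ^ 2 + 2 * y * z) * corrSer 0 0 + x * z ^ 2 * corrSer 0 1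
    + x * y ^ 2 * corrSer 1 0 = ser initCoeff + x ^ 1 * y ^ 0 * z ^ 0 * corrSer 0 0
      + 4 • (x ^ 1 * y ^ 1 * z ^ 1 * corrSer 0 0) + x ^ 1 * y ^ 2 * z ^ 2 * corrSer 0 0
      + x ^ 1 * y ^ 0 * z ^ 2 * corrSer 0 1 + x ^ 1 * y ^ 2 * z ^ 0 * corrSer 1 0 := by
    ring
  rw [this]
  simp only [corrSer, monomial_mul_ser h00, monomial_mul_ser h01, monomial_mul_ser h10]
  ext e
  simp only [map_add, map_nsmul, coeff_ser]
  rcases h : e 0 with _ | l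
  · have h' : ((0 : ℕ) : ℤ) - (1 : ℕ) < 0 := by simp
    rw [h00 _ _ _ (Or.inl h'), h00 _ _ _ (Or.inl h'), h00 _ _ _ (Or.inl h'),
      h01 _ _ _ (Or.inl h'), h10 _ _ _ (Or.inl h')]
    rw [Nat.cast_zero, blockCorr_zero 0 0 (by simp) (by simp)]
    simp [initCoeff]
  · have h' : ((l + 1 : ℕ) : ℤ) - (1 : ℕ) = l := by push_cast; ring
    have hi : initCoeff ((l + 1 : ℕ) : ℤ) (e 1) (e 2) = 0 := by
      rw [initCoeff, if_neg (by omega)]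
    rw [h', hi]
    simp only [blockCorr_natCast, add_zero, nsmul_eq_mul]
    rw [pow_succ, mul_assoc, four_mul_blockSum_diag]
    simp only [blockSum_left, Finset.sum_add_distrib, ← Finset.mul_sum]
    push_cast
    ring_nf

lemma corrSer_right : corrSer 0 1 = ser initCoeff
    + 2 * x * y * (1 + y * z) * corrSer 0 0 + 2 * x * z * (1 + y * z) * corrSer 0 1 := by
  have h00 := octantSupported_δ (a := 0) (b := 0) (by simp) (by simp)
  have h01 := octantSupported_δ (a := 0) (b := 1) (by simp) (by simp)
  have : ser initCoeff
    + 2 * x * y * (1 + y * z) * corrSer 0 0 + 2 * x * z * (1 + y * z) * corrSer 0 1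
    = ser initCoeff + 2 • (x ^ 1 * y ^ 1 * z ^ 0 * corrSer 0 0)
      + 2 • (x ^ 1 * y ^ 2 * z ^ 1 * corrSer 0 0) + 2 • (x ^ 1 * y ^ 0 * z ^ 1 * corrSer 0 1)
      + 2 • (x ^ 1 * y ^ 1 * z ^ 2 * corrSer 0 1) := by
    ring
  rw [this]
  simp only [corrSer, monomial_mul_ser h00, monomial_mul_ser h01]
  ext e
  simp only [map_add, map_nsmul, coeff_ser]
  rcases h : e 0 with _ | l
  · have h' : ((0 : ℕ) : ℤ) - (1 : ℕ) < 0 := by simp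
    rw [h00 _ _ _ (Or.inl h'), h00 _ _ _ (Or.inl h'), h01 _ _ _ (Or.inl h'),
      h01 _ _ _ (Or.inl h')]
    rw [Nat.cast_zero, blockCorr_zero 0 1 (by simp) (by simp)]
    simp [initCoeff]
  · have h' : ((l + 1 : ℕ) : ℤ) - (1 : ℕ) = l := by push_cast; ring
    have hi : initCoeff ((l + 1 : ℕ) : ℤ) (e 1) (e 2) = 0 := by
      rw [initCoeff, if_neg (by omega)]
    rw [h', hi]
    simp only [blockCorr_natCast, add_zero, nsmul_eq_mul]
    rw [pow_succ, mul_assoc, four_mul_blockSum_right]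
    simp only [Finset.sum_add_distrib, ← Finset.mul_sum]
    push_cast
    ring_nf

lemma corrSer_left : corrSer 1 0 = ser initCoeff
    + 2 * x * z * (1 + y * z) * corrSer 0 0 + 2 * x * y * (1 + y * z) * corrSer 1 0 := by
  have h00 := octantSupported_δ (a := 0) (b := 0) (by simp) (by simp)
  have h10 := octantSupported_δ (a := 1) (b := 0) (by simp) (by simp)
  have : ser initCoeff
    + 2 * x * z * (1 + y * z) * corrSer 0 0 + 2 * x * y * (1 + y * z) * corrSer 1 0
    = ser initCoeff + 2 • (x ^ 1 * y ^ 0 * z ^ 1 * corrSer 0 0)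
      + 2 • (x ^ 1 * y ^ 1 * z ^ 2 * corrSer 0 0) + 2 • (x ^ 1 * y ^ 1 * z ^ 0 * corrSer 1 0)
      + 2 • (x ^ 1 * y ^ 2 * z ^ 1 * corrSer 1 0) := by
    ring
  rw [this]
  simp only [corrSer, monomial_mul_ser h00, monomial_mul_ser h10]
  ext e
  simp only [map_add, map_nsmul, coeff_ser]
  rcases h : e 0 with _ | l
  · have h' : ((0 : ℕ) : ℤ) - (1 : ℕ) < 0 := by simp
    rw [h00 _ _ _ (Or.inl h'), h00 _ _ _ (Or.inl h'), h10 _ _ _ (Or.inl h'),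
      h10 _ _ _ (Or.inl h')]
    rw [Nat.cast_zero, blockCorr_zero 1 0 (by simp) (by simp)]
    simp [initCoeff]
  · have h' : ((l + 1 : ℕ) : ℤ) - (1 : ℕ) = l := by push_cast; ring
    have hi : initCoeff ((l + 1 : ℕ) : ℤ) (e 1) (e 2) = 0 := by
      rw [initCoeff, if_neg (by omega)]
    rw [h', hi]
    simp only [blockCorr_natCast, add_zero, nsmul_eq_mul, blockSum_left]
    rw [pow_succ, mul_assoc, four_mul_blockSum_right]
    simp only [Finset.sum_add_distrib, ← Finset.mul_sum]
    push_cast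
    ring_nf
    simp only [mul_comm]
    ring

/-- Elimination of `corrSer 0 1` and `corrSer 1 0`. With a = (1-2xz(1+yz))⁻¹, substitution produces
xyz·2xz(1+yz)·a = xyz(a-1), and likewise with y and z exchanged; the two terms -xyz cancel the 2xyz
of `corrSer_diag` and leave `H`. -/
lemma corrSer_eq_A : corrSer 0 0 = A := by
  have hx : MvPowerSeries.constantCoeff x = 0 := MvPowerSeries.constantCoeff_X 0
  have hy : MvPowerSeries.constantCoeff y = 0 := MvPowerSeries.constantCoeff_X 1
  have hz : MvPowerSeries.constantCoeff z = 0 := MvPowerSeries.constantCoeff_X 2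
  have h2 : MvPowerSeries.constantCoeff (2 : Series3) = 2 := map_ofNat _ 2
  have ha := MvPowerSeries.mul_inv_cancel (1 - 2 * x * z * (1 + y * z) : Series3)
    (by simp [hx])
  have hb := MvPowerSeries.mul_inv_cancel (1 - 2 * x * y * (1 + y * z) : Series3)
    (by simp [hx])
  have hc := MvPowerSeries.mul_inv_cancel (2 - y : Series3) (by simp [hy, h2])
  have hd := MvPowerSeries.mul_inv_cancel (2 - z : Series3) (by simp [hz, h2])
  have hH : MvPowerSeries.constantCoeff H ≠ 0 := by simp [H, hx]
  rw [A, MvPowerSeries.eq_mul_inv_iff_mul_eq hH]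
  have h0 : ser initCoeff = (2 - y)⁻¹ * (2 - z)⁻¹ := by
    linear_combination (2 - y)⁻¹ * (2 - z)⁻¹ * sub_mul_sub_mul_ser_initCoeff
      - ser initCoeff * (2 - z) * (2 - z)⁻¹ * hc - ser initCoeff * hd
  rw [← h0, H, numer]
  have e1 := corrSer_diag
  have e2 := corrSer_right
  have e3 := corrSer_left
  generalize corrSer 0 0 = S at *
  generalize corrSer 0 1 = T at *
  generalize corrSer 1 0 = U at *
  generalize (1 - 2 * x * z * (1 + y * z) : Series3)⁻¹ = a at *
  generalize (1 - 2 * x * y * (1 + y * z) : Series3)⁻¹ = b at *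
  linear_combination e1 + x * z ^ 2 * a * e2 + x * y ^ 2 * b * e3
    + (-(x * y * z * S) - x * z ^ 2 * T) * ha + (-(x * y * z * S) - x * y ^ 2 * U) * hb

/-- The series with coefficients `4^l ∑ₜ tailDens(l+1-j,t) tailDens(l+1-k,t)` is `F`. -/
lemma ser_tailDens_eq_F : ser (blockCorr tailDens 0 0) = F := by
  have hs : OctantSupported (blockCorr tailDens 0 0) :=
    octantSupported_blockCorr (fun _ _ => tailDens_eq_zero) (by simp) (by simp)
  have hy : MvPowerSeries.constantCoeff y = 0 := MvPowerSeries.constantCoeff_X 1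
  have hz : MvPowerSeries.constantCoeff z = 0 := MvPowerSeries.constantCoeff_X 2
  rw [F, MvPowerSeries.eq_mul_inv_iff_mul_eq (by simp [hy, hz]), ← corrSer_eq_A]
  have : ser (blockCorr tailDens 0 0) * ((1 - y) * (1 - z)) = ser (blockCorr tailDens 0 0)
      - x ^ 0 * y ^ 1 * z ^ 0 * ser (blockCorr tailDens 0 0)
      - x ^ 0 * y ^ 0 * z ^ 1 * ser (blockCorr tailDens 0 0)
      + x ^ 0 * y ^ 1 * z ^ 1 * ser (blockCorr tailDens 0 0) := by
    ring
  rw [this]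
  simp only [corrSer, monomial_mul_ser hs]
  ext e
  simp only [map_add, map_sub, coeff_ser, Nat.cast_zero, sub_zero, blockCorr_natCast, add_zero,
    ← mul_sub, ← mul_add, ← Finset.sum_sub_distrib, ← Finset.sum_add_distrib]
  congr 1
  refine Finset.sum_congr rfl fun t _ => ?_
  -- Multiplication by 1-y takes differences in j, which turns the first tail into a point density;
  -- 1-z does the same to the second.
  have h1 := tailDens_eq_add (e 0 + 1 - e 1) t
  have h2 := tailDens_eq_add (e 0 + 1 - e 2) t
  rw [show (e 0 : ℤ) + 1 - e 1 + 1 = e 0 + 1 - (e 1 - (1 : ℕ)) by push_cast; ring] at h1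
  rw [show (e 0 : ℤ) + 1 - e 2 + 1 = e 0 + 1 - (e 2 - (1 : ℕ)) by push_cast; ring] at h2
  rw [h1, h2]
  ring

lemma coeff3_A (l j k : ℕ) : coeff3 l j k A =
    (4 : ℝ) ^ l * ∑ t ∈ Finset.Ico (2 ^ l) (2 ^ (l + 1)),
      δ ((l : ℤ) + 1 - (j : ℤ)) t * δ ((l : ℤ) + 1 - (k : ℤ)) t := by
  rw [← corrSer_eq_A, coeff3_ser, blockCorr_natCast]
  simp

/-- Since 8^l = 4^l·2^l, the weight 4^l cancels and a block mean remains. The diagonals j = l+1 and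
j = l give m = 0 (c_t) and m = 1 (c̃_t). -/
lemma coeff3_F_div (l j : ℕ) (m : ℤ) (hm : (l : ℤ) + 1 - j = m) : coeff3 l j j F / 8 ^ l =
    (∑ t ∈ Finset.Ico (2 ^ l) (2 ^ (l + 1)), tailDens m t ^ 2) / 2 ^ l := by
  rw [← ser_tailDens_eq_F, coeff3_ser, blockCorr_natCast, hm,
    show (8 : ℝ) = 4 * 2 by norm_num, mul_pow, mul_div_mul_left _ _ (by positivity)]
  simp [sq]

open MeasureTheory intervalIntegral

/-! ### Fourier representation of the tail densities -/

/-- The phase `e^{imθ}`. -/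
def phase (θ : ℝ) (m : ℤ) : ℂ := Complex.exp (((m * θ : ℝ) : ℂ) * Complex.I)

lemma phase_re (θ : ℝ) (m : ℤ) : (phase θ m).re = Real.cos (m * θ) :=
  Complex.exp_ofReal_mul_I_re _

lemma phase_im (θ : ℝ) (m : ℤ) : (phase θ m).im = Real.sin (m * θ) :=
  Complex.exp_ofReal_mul_I_im _

lemma norm_phase (θ : ℝ) (m : ℤ) : ‖phase θ m‖ = 1 := Complex.norm_exp_ofReal_mul_I _

lemma phase_zero (θ : ℝ) : phase θ 0 = 1 := by simp [phase]

lemma phase_add (θ : ℝ) (m n : ℤ) : phase θ (m + n) = phase θ m * phase θ n := by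
  rw [phase, phase, phase, ← Complex.exp_add]
  push_cast
  ring_nf

lemma continuous_phase (m : ℤ) : Continuous fun θ => phase θ m := by
  unfold phase
  fun_prop

/-- The characteristic function of `s(n+t) - s(n)`, divided by that for `t = 1`. -/
def charFn (θ : ℝ) (t : ℕ) : ℂ :=
  if ht : t ≤ 1 then 1
  else if t % 2 = 0 then charFn θ (t / 2)
  else (phase θ 1 * charFn θ (t / 2) + phase θ (-1) * charFn θ (t / 2 + 1)) / 2
termination_by t

lemma charFn_one (θ : ℝ) : charFn θ 1 = 1 := by rw [charFn]; simp

lemma charFn_two_mul (θ : ℝ) (t : ℕ) : charFn θ (2 * t) = charFn θ t := by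
  rcases Nat.eq_zero_or_pos t with rfl | ht
  · simp
  · rw [charFn, dif_neg (by omega), if_pos (by omega), show 2 * t / 2 = t by omega]

lemma charFn_two_mul_add_one (θ : ℝ) {t : ℕ} (ht : 1 ≤ t) :
    charFn θ (2 * t + 1)
      = (phase θ 1 * charFn θ t + phase θ (-1) * charFn θ (t + 1)) / 2 := by
  rw [charFn, dif_neg (by omega), if_neg (by omega), show (2 * t + 1) / 2 = t by omega]

/-- The characteristic function of `s(n+1) - s(n)`, that is `e^{iθ}/(2-e^{-iθ})`. -/
def charFnOne (θ : ℝ) : ℂ :=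
  (((5 - 4 * Real.cos θ)⁻¹ : ℝ) : ℂ) * (phase θ 1 * (2 - phase θ 1))

lemma five_sub_pos (θ : ℝ) : 1 ≤ 5 - 4 * Real.cos θ := by linarith [Real.cos_le_one θ]

/-- The odd rule at 1 = 2·0+1 in Fourier form; it characterises `charFnOne`. -/
lemma two_mul_charFnOne (θ : ℝ) :
    2 * charFnOne θ = phase θ 1 + phase θ (-1) * charFnOne θ := by
  have h : phase θ 1 * phase θ (-1) = 1 := by rw [← phase_add]; simp [phase_zero]
  have h5 : ((5 - 4 * Real.cos θ : ℝ) : ℂ) ≠ 0 := by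
    exact_mod_cast (by linarith [five_sub_pos θ] : (5 - 4 * Real.cos θ : ℝ) ≠ 0)
  have hc : phase θ 1 + phase θ (-1) = 2 * (Real.cos θ : ℂ) := by
    apply Complex.ext <;> simp [phase_re, phase_im, -Complex.ofReal_cos]
    ring
  rw [charFnOne, Complex.ofReal_inv]
  field_simp
  simp only [Complex.ofReal_sub, Complex.ofReal_mul, Complex.ofReal_ofNat]
  linear_combination phase θ 1 * h - 2 * phase θ 1 * hc

/-- Continuous functions for which `imPart * cot (θ/2)` is bounded. -/
def Admissible (f : ℝ → ℂ) : Prop :=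
  Continuous f ∧ ∃ K, ∀ θ, ‖f θ‖ ≤ K ∧ |(f θ).im| ≤ K * |Real.sin (θ / 2)|

lemma Admissible.add {f g : ℝ → ℂ} (hf : Admissible f) (hg : Admissible g) :
    Admissible fun θ => f θ + g θ := by
  obtain ⟨hf, K, hK⟩ := hf
  obtain ⟨hg, L, hL⟩ := hg
  refine ⟨hf.add hg, K + L, fun θ => ⟨?_, ?_⟩⟩
  · exact (norm_add_le _ _).trans (add_le_add (hK θ).1 (hL θ).1)
  · rw [Complex.add_im, add_mul]
    exact (abs_add_le _ _).trans (add_le_add (hK θ).2 (hL θ).2)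

lemma Admissible.mul {f g : ℝ → ℂ} (hf : Admissible f) (hg : Admissible g) :
    Admissible fun θ => f θ * g θ := by
  obtain ⟨hf, K, hK⟩ := hf
  obtain ⟨hg, L, hL⟩ := hg
  have hK0 : 0 ≤ K := (norm_nonneg _).trans (hK 0).1
  have hL0 : 0 ≤ L := (norm_nonneg _).trans (hL 0).1
  refine ⟨hf.mul hg, 2 * (K * L), fun θ => ⟨?_, ?_⟩⟩
  · rw [norm_mul]
    calc ‖f θ‖ * ‖g θ‖ ≤ K * L := mul_le_mul (hK θ).1 (hL θ).1 (norm_nonneg _) hK0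
      _ ≤ 2 * (K * L) := by nlinarith [mul_nonneg hK0 hL0]
  · rw [Complex.mul_im]
    calc |(f θ).re * (g θ).im + (f θ).im * (g θ).re|
        ≤ |(f θ).re| * |(g θ).im| + |(f θ).im| * |(g θ).re| := by
          rw [← abs_mul, ← abs_mul]; exact abs_add_le _ _
      _ ≤ K * (L * |Real.sin (θ / 2)|) + K * |Real.sin (θ / 2)| * L := by
          gcongr
          · exact (Complex.abs_re_le_norm _).trans (hK θ).1
          · exact (hL θ).2
          · exact (hK θ).2
          · exact (Complex.abs_re_le_norm _).trans (hL θ).1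
      _ = 2 * (K * L) * |Real.sin (θ / 2)| := by ring

lemma Admissible.ofReal {f : ℝ → ℝ} (hf : Continuous f) {K : ℝ} (hK : ∀ θ, |f θ| ≤ K) :
    Admissible fun θ => (f θ : ℂ) := by
  have hK0 : 0 ≤ K := (abs_nonneg _).trans (hK 0)
  refine ⟨Complex.continuous_ofReal.comp hf, K, fun θ => ⟨?_, ?_⟩⟩
  · rw [Complex.norm_real]; exact hK θ
  · rw [Complex.ofReal_im, abs_zero]; positivity

lemma abs_sin_nat_mul_le (n : ℕ) (a : ℝ) : |Real.sin (n * a)| ≤ n * |Real.sin a| := by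
  induction n with
  | zero => simp
  | succ n ih =>
    push_cast
    rw [add_mul, one_mul, Real.sin_add, add_mul, one_mul]
    refine (abs_add_le _ _).trans (add_le_add ?_ ?_)
    · rw [abs_mul]
      exact (mul_le_of_le_one_right (abs_nonneg _) (Real.abs_cos_le_one _)).trans ih
    · rw [abs_mul]
      exact mul_le_of_le_one_left (abs_nonneg _) (Real.abs_cos_le_one _)

/-- The zero at θ = 0 must be measured by sin(θ/2), so mθ is read as 2|m| copies of θ/2. The growth
in m is only linear, as `exists_linear_bound` requires. -/
lemma abs_phase_im_le (θ : ℝ) (m : ℤ) :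
    |(phase θ m).im| ≤ 2 * |(m : ℝ)| * |Real.sin (θ / 2)| := by
  have h := abs_sin_nat_mul_le (2 * m.natAbs) (θ / 2)
  rw [phase_im]
  push_cast [Nat.cast_natAbs] at h
  rw [show 2 * |(m : ℝ)| * (θ / 2) = |(m : ℝ)| * θ by ring] at h
  rcases abs_cases (m : ℝ) with ⟨h1, _⟩ | ⟨h1, _⟩
  · rw [h1] at h ⊢; exact h
  · rw [h1] at h ⊢
    rwa [neg_mul, Real.sin_neg, abs_neg] at h

lemma admissible_phase (m : ℤ) : Admissible fun θ => phase θ m := by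
  refine ⟨continuous_phase m, 1 + 2 * |(m : ℝ)|, fun θ => ⟨?_, ?_⟩⟩
  · rw [norm_phase]; linarith [abs_nonneg (m : ℝ)]
  · refine (abs_phase_im_le θ m).trans ?_
    gcongr
    linarith

lemma admissible_const (a : ℝ) : Admissible fun _ => (a : ℂ) :=
  Admissible.ofReal (f := fun _ => a) continuous_const (K := |a|) fun _ => le_rfl

lemma admissible_charFn (t : ℕ) : Admissible fun θ => charFn θ t := by
  induction t using Nat.strong_induction_on with
  | _ t ih =>
    rcases le_or_gt t 1 with ht | ht
    · have : (fun θ => charFn θ t) = fun _ => ((1 : ℝ) : ℂ) := by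
        ext θ; rw [charFn, dif_pos ht]; simp
      rw [this]
      exact admissible_const 1
    · rcases Nat.even_or_odd' t with ⟨a, rfl | rfl⟩
      · simp only [charFn_two_mul]
        exact ih a (by omega)
      · have h := (((admissible_phase 1).mul (ih a (by omega))).add
          ((admissible_phase (-1)).mul (ih (a + 1) (by omega)))).mul (admissible_const (1 / 2))
        convert h using 2 with θ
        rw [charFn_two_mul_add_one θ (by omega)]
        push_cast
        ring

lemma admissible_charFnOne : Admissible charFnOne := by
  have h : Continuous fun θ => (5 - 4 * Real.cos θ)⁻¹ :=
    Continuous.inv₀ (by fun_prop) fun θ => by linarith [five_sub_pos θ]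
  have h1 := Admissible.ofReal h (K := 1) fun θ => by
    rw [abs_inv, abs_of_pos (by linarith [five_sub_pos θ])]
    exact inv_le_one_of_one_le₀ (five_sub_pos θ)
  have h2 := h1.mul ((admissible_phase 1).mul
    ((admissible_const 2).add ((admissible_const (-1)).mul (admissible_phase 1))))
  convert h2 using 2 with θ
  rw [charFnOne]
  push_cast
  ring

/-- The real-linear functional `Re w + Im w * cot (θ/2)`. -/
def cotPair (θ : ℝ) (w : ℂ) : ℝ := w.re + w.im * (Real.cos (θ / 2) / Real.sin (θ / 2))

lemma cotPair_add (θ : ℝ) (v w : ℂ) : cotPair θ (v + w) = cotPair θ v + cotPair θ w := by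
  simp [cotPair]; ring

lemma cotPair_ofReal_mul (θ a : ℝ) (w : ℂ) : cotPair θ ((a : ℂ) * w) = a * cotPair θ w := by
  simp [cotPair]; ring

lemma abs_cotPair_le {θ K : ℝ} {w : ℂ} (h1 : ‖w‖ ≤ K) (h2 : |w.im| ≤ K * |Real.sin (θ / 2)|) :
    |cotPair θ w| ≤ 2 * K := by
  have hK : 0 ≤ K := (norm_nonneg _).trans h1
  rw [cotPair, two_mul]
  refine (abs_add_le _ _).trans (add_le_add ((Complex.abs_re_le_norm _).trans h1) ?_)
  rw [abs_mul, abs_div]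
  calc |w.im| * (|Real.cos (θ / 2)| / |Real.sin (θ / 2)|)
      ≤ K * |Real.sin (θ / 2)| * (1 / |Real.sin (θ / 2)|) := by
        gcongr
        exact Real.abs_cos_le_one _
    _ = K * (|Real.sin (θ / 2)| / |Real.sin (θ / 2)|) := by ring
    _ ≤ K * 1 := by gcongr; exact div_self_le_one _
    _ = K := mul_one K

lemma Admissible.measurable_cotPair {f : ℝ → ℂ} (hf : Admissible f) :
    Measurable fun θ => cotPair θ (f θ) := by
  have := hf.1.measurable
  unfold cotPair
  fun_prop

lemma intervalIntegrable_of_bounded {h : ℝ → ℝ} (hm : Measurable h) {K : ℝ} (hK : ∀ θ, |h θ| ≤ K)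
    (a b : ℝ) : IntervalIntegrable h volume a b := by
  rw [intervalIntegrable_iff]
  exact Measure.integrableOn_of_bounded (M := K) (by simp) hm.aestronglyMeasurable
    (Eventually.of_forall hK)

lemma Admissible.exists_bound {f : ℝ → ℂ} (hf : Admissible f) :
    ∃ K, ∀ θ, |cotPair θ (f θ)| ≤ K := by
  obtain ⟨_, K, hK⟩ := hf
  exact ⟨2 * K, fun θ => abs_cotPair_le (hK θ).1 (hK θ).2⟩

lemma Admissible.intervalIntegrable {f : ℝ → ℂ} (hf : Admissible f) (a b : ℝ) :
    IntervalIntegrable (fun θ => cotPair θ (f θ)) volume a b :=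
  intervalIntegrable_of_bounded hf.measurable_cotPair hf.exists_bound.choose_spec a b

/-- The functional which sends `θ ↦ e^{ikθ}` to the indicator of `k ≥ 0`. -/
def tailFunctional (f : ℝ → ℂ) : ℝ :=
  1 / 2 + (1 / (2 * Real.pi)) * ∫ θ in (0 : ℝ)..Real.pi, cotPair θ (f θ)

lemma tailFunctional_half_add {f g h : ℝ → ℂ} (hg : Admissible g) (hh : Admissible h)
    (hf : ∀ θ, f θ = (g θ + h θ) / 2) :
    tailFunctional f = (tailFunctional g + tailFunctional h) / 2 := by
  have : ∀ θ, cotPair θ (f θ) = (1 / 2) * (cotPair θ (g θ) + cotPair θ (h θ)) := by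
    intro θ
    rw [hf, ← cotPair_add, ← cotPair_ofReal_mul]
    congr 1
    push_cast
    ring
  simp only [tailFunctional, this]
  rw [intervalIntegral.integral_const_mul, intervalIntegral.integral_add
    (hg.intervalIntegrable _ _) (hh.intervalIntegrable _ _)]
  ring

lemma integral_cos_int_mul (m : ℤ) :
    ∫ θ in (0 : ℝ)..Real.pi, Real.cos (m * θ) = if m = 0 then Real.pi else 0 := by
  split_ifs with hm
  · simp [hm]
  · rw [intervalIntegral.integral_comp_mul_left _ (by exact_mod_cast hm)]
    simp

/-- The telescoping identity of conjugate Dirichlet kernels: raising m by one changes the integrand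
by 2cos(mθ), whose integral over [0,π] detects m = 0. -/
lemma cotPair_phase_sub {θ : ℝ} (h : Real.sin (θ / 2) ≠ 0) (m : ℤ) :
    cotPair θ (phase θ (-m)) = cotPair θ (phase θ (-(m + 1))) + 2 * Real.cos (m * θ) := by
  have e1 : Real.cos θ = 2 * Real.cos (θ / 2) ^ 2 - 1 := by
    rw [← Real.cos_two_mul]; congr 1; ring
  have e2 : Real.sin θ = 2 * Real.sin (θ / 2) * Real.cos (θ / 2) := by
    rw [← Real.sin_two_mul]; congr 1; ring
  have e3 := Real.sin_sq_add_cos_sq (θ / 2)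
  simp only [cotPair, phase_re, phase_im]
  push_cast
  simp only [neg_mul, Real.sin_neg, Real.cos_neg, add_mul, one_mul, Real.cos_add, Real.sin_add, e1,
    e2]
  field_simp
  generalize Real.cos (m * θ) = A
  generalize Real.sin (m * θ) = B
  generalize Real.cos (θ / 2) = C at *
  generalize Real.sin (θ / 2) = S at *
  linear_combination 2 * B * C * e3

lemma tailFunctional_phase (m : ℤ) :
    tailFunctional (fun θ => phase θ (-m)) = if m ≤ 0 then 1 else 0 := by
  have step : ∀ m : ℤ, tailFunctional (fun θ => phase θ (-m))
      = tailFunctional (fun θ => phase θ (-(m + 1))) + if m = 0 then 1 else 0 := by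
    intro m
    have h : ∫ θ in (0 : ℝ)..Real.pi, cotPair θ (phase θ (-m))
        = ∫ θ in (0 : ℝ)..Real.pi,
          (cotPair θ (phase θ (-(m + 1))) + 2 * Real.cos (m * θ)) := by
      refine intervalIntegral.integral_congr_ae (Eventually.of_forall fun θ hθ => ?_)
      rw [Set.uIoc_of_le Real.pi_pos.le] at hθ
      refine cotPair_phase_sub (Real.sin_pos_of_pos_of_lt_pi ?_ ?_).ne' m
      · linarith [hθ.1]
      · linarith [hθ.2, Real.pi_pos]
    rw [tailFunctional, h, intervalIntegral.integral_add
      ((admissible_phase _).intervalIntegrable _ _)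
      (Continuous.intervalIntegrable (by fun_prop) _ _), intervalIntegral.integral_const_mul,
      integral_cos_int_mul, tailFunctional]
    have := Real.pi_pos.ne'
    split_ifs <;> field_simp <;> ring
  have h0 : tailFunctional (fun θ => phase θ (-0)) = 1 := by
    simp [tailFunctional, phase_zero, cotPair]
    field_simp
    norm_num
  induction m using Int.induction_on with
  | zero => simpa using h0
  | succ i ih =>
    have := step i
    rw [ih] at this
    rw [if_neg (by omega)]
    split_ifs at this <;> first | omega | linarith
  | pred i ih =>
    have := step (-i - 1)
    rw [show (-(i : ℤ) - 1 + 1) = -i by ring, ih, if_pos (by omega), if_neg (by omega)] at this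
    rw [this, if_pos (by omega), add_zero]

lemma exists_linear_bound :
    ∃ K, ∀ m : ℤ, |tailFunctional (fun θ => charFnOne θ * phase θ (-m))| ≤ K * (1 + |(m : ℝ)|) := by
  obtain ⟨_, K, hK⟩ := admissible_charFnOne
  have hK0 : 0 ≤ K := (norm_nonneg _).trans (hK 0).1
  refine ⟨1 + 2 * K, fun m => ?_⟩
  have hb : ∀ θ, |cotPair θ (charFnOne θ * phase θ (-m))| ≤ 2 * (K + 2 * K * |(m : ℝ)|) := by
    intro θ
    apply abs_cotPair_le
    · rw [norm_mul, norm_phase, mul_one]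
      refine (hK θ).1.trans ?_
      have : 0 ≤ K * |(m : ℝ)| := by positivity
      linarith
    · rw [Complex.mul_im]
      refine (abs_add_le _ _).trans ?_
      rw [abs_mul, abs_mul]
      have h1 := abs_phase_im_le θ (-m)
      have h2 : |(phase θ (-m)).re| ≤ 1 := by
        rw [phase_re]; exact Real.abs_cos_le_one _
      push_cast at h1
      rw [abs_neg] at h1
      calc _ ≤ K * (2 * |(m : ℝ)| * |Real.sin (θ / 2)|) + K * |Real.sin (θ / 2)| * 1 := by
            gcongr
            · exact (Complex.abs_re_le_norm _).trans (hK θ).1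
            · exact (hK θ).2
        _ = _ := by ring
  have hi := intervalIntegral.norm_integral_le_of_norm_le_const (a := 0) (b := Real.pi)
    (f := fun θ => cotPair θ (charFnOne θ * phase θ (-m))) (fun θ _ => hb θ)
  rw [Real.norm_eq_abs, sub_zero, abs_of_pos Real.pi_pos] at hi
  have hp := Real.pi_pos
  rw [tailFunctional]
  refine (abs_add_le _ _).trans ?_
  rw [abs_mul, abs_of_pos (by positivity : (0 : ℝ) < 1 / (2 * Real.pi))]
  calc _ ≤ |(1 : ℝ) / 2| + 1 / (2 * Real.pi) * (2 * (K + 2 * K * |(m : ℝ)|) * Real.pi) := by gcongr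
    _ = 1 / 2 + (K + 2 * K * |(m : ℝ)|) := by
      rw [abs_of_pos (by norm_num)]; field_simp
    _ ≤ _ := by nlinarith [abs_nonneg (m : ℝ)]

/-- Both sides satisfy the odd rule for t = 1, so their difference obeys D(m) = D(m+1)/2, hence D(m)
= D(m+j)/2^j. By `exists_linear_bound` D grows at most linearly, so it vanishes. No Fourier series
needs to be summed. -/
lemma tailFunctional_charFnOne (m : ℤ) :
    tailFunctional (fun θ => charFnOne θ * phase θ (-m)) = tailDens m 1 := by
  set D : ℤ → ℝ := fun m =>
    tailFunctional (fun θ => charFnOne θ * phase θ (-m)) - tailDens m 1 with hD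
  have step : ∀ m, D m = D (m + 1) / 2 := by
    intro m
    have h1 := tailFunctional_half_add (f := fun θ => charFnOne θ * phase θ (-m))
      (admissible_phase (-(m - 1))) (admissible_charFnOne.mul (admissible_phase (-(m + 1))))
      (fun θ => by
        rw [show -(m - 1) = 1 + -m by ring, show -(m + 1) = -1 + -m by ring, phase_add, phase_add]
        linear_combination (phase θ (-m) / 2) * two_mul_charFnOne θ)
    have h2 := tailDens_two_mul_add_one m 0
    rw [tailDens_zero] at h2
    simp only [mul_zero, zero_add] at h2
    simp only [hD]
    rw [h1, h2, tailFunctional_phase]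
    ring
  have iter : ∀ (j : ℕ) (m : ℤ), D m = D (m + j) / 2 ^ j := by
    intro j
    induction j with
    | zero => intro m; simp
    | succ j ih =>
      intro m
      rw [ih m, step (m + j), pow_succ]
      push_cast
      rw [add_assoc, div_div, mul_comm]
  obtain ⟨K, hK⟩ := exists_linear_bound
  have hb : ∀ m, |D m| ≤ K * (1 + |(m : ℝ)|) + 1 := by
    intro m
    refine (abs_sub _ _).trans (add_le_add (hK m) ?_)
    have := tailDens_mem_Icc m 1
    rw [abs_of_nonneg this.1]
    exact this.2
  have hK0 : 0 ≤ K := by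
    have := (abs_nonneg _).trans (hK 0)
    simpa using this
  have hlim : Tendsto (fun j : ℕ => (K * (1 + |(m : ℝ)|) + 1) * (1 / 2 : ℝ) ^ j
      + K * (j * (1 / 2 : ℝ) ^ j)) atTop (𝓝 0) := by
    have h1 := tendsto_pow_atTop_nhds_zero_of_lt_one (r := (1 / 2 : ℝ)) (by norm_num) (by norm_num)
    have h2 := tendsto_self_mul_const_pow_of_lt_one (r := (1 / 2 : ℝ)) (by norm_num) (by norm_num)
    simpa using (h1.const_mul (K * (1 + |(m : ℝ)|) + 1)).add (h2.const_mul K)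
  have : |D m| ≤ 0 := by
    refine ge_of_tendsto' hlim fun j => ?_
    rw [iter j m, abs_div, abs_of_pos (by positivity : (0 : ℝ) < 2 ^ j)]
    have h3 := hb (m + j)
    have h4 : |((m + j : ℤ) : ℝ)| ≤ |(m : ℝ)| + j := by
      push_cast
      exact (abs_add_le _ _).trans (by simp)
    rw [one_div, inv_pow, div_eq_mul_inv]
    have h5 : |D (m + j)| ≤ K * (1 + |(m : ℝ)|) + 1 + K * j := by nlinarith
    calc _ ≤ (K * (1 + |(m : ℝ)|) + 1 + K * j) * ((2 : ℝ) ^ j)⁻¹ := by gcongr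
      _ = _ := by ring
  have h0 : D m = 0 := abs_eq_zero.1 (le_antisymm this (abs_nonneg _))
  linarith [h0, hD ▸ h0]

/-- Both sides obey the same parity rules in t. The case t = 0 is excluded because `charFn θ 0` is
only a default value. -/
lemma tailDens_eq_tailFunctional (m : ℤ) {t : ℕ} (ht : 1 ≤ t) :
    tailDens m t = tailFunctional (fun θ => charFnOne θ * charFn θ t * phase θ (-m)) := by
  induction t using Nat.strong_induction_on generalizing m with
  | _ t ih =>
    rcases ht.eq_or_lt with rfl | ht1
    · simp only [charFn_one, mul_one, tailFunctional_charFnOne]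
    · rcases Nat.even_or_odd' t with ⟨a, rfl | rfl⟩
      · simp only [tailDens_two_mul, charFn_two_mul]
        exact ih a (by omega) m (by omega)
      · rw [tailDens_two_mul_add_one, ih a (by omega) _ (by omega),
          ih (a + 1) (by omega) _ (by omega)]
        refine (tailFunctional_half_add
          ((admissible_charFnOne.mul (admissible_charFn _)).mul (admissible_phase _))
          ((admissible_charFnOne.mul (admissible_charFn _)).mul (admissible_phase _))
          fun θ => ?_).symm
        rw [charFn_two_mul_add_one θ (by omega), show -(m - 1) = 1 + -m by ring,
          show -(m + 1) = -1 + -m by ring, phase_add, phase_add]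
        ring

/-! ### Second moments of the characteristic functions over a dyadic block -/

/-- The mean of `G` over the dyadic block `[2^l, 2^(l+1))`. -/
def blockMean (l : ℕ) (G : ℕ → ℝ) : ℝ :=
  (∑ t ∈ Finset.Ico (2 ^ l) (2 ^ (l + 1)), G t) / 2 ^ l

lemma blockMean_congr {l : ℕ} {G G' : ℕ → ℝ} (h : ∀ t, 1 ≤ t → G t = G' t) :
    blockMean l G = blockMean l G' := by
  unfold blockMean
  congr 1
  refine Finset.sum_congr rfl fun t ht => h t ?_
  exact Nat.one_le_two_pow.trans (Finset.mem_Ico.1 ht).1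

lemma blockMean_add (l : ℕ) (G G' : ℕ → ℝ) :
    blockMean l (fun t => G t + G' t) = blockMean l G + blockMean l G' := by
  simp [blockMean, Finset.sum_add_distrib, add_div]

lemma blockMean_const_mul (l : ℕ) (a : ℝ) (G : ℕ → ℝ) :
    blockMean l (fun t => a * G t) = a * blockMean l G := by
  simp [blockMean, ← Finset.mul_sum, mul_div_assoc]

lemma blockMean_const (l : ℕ) (a : ℝ) : blockMean l (fun _ => a) = a := by
  simp [blockMean, pow_succ, mul_two]

lemma blockMean_zero (G : ℕ → ℝ) : blockMean 0 G = G 1 := by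
  simp [blockMean]

lemma blockMean_succ (l : ℕ) (G : ℕ → ℝ) :
    blockMean (l + 1) G = blockMean l fun t => (G (2 * t) + G (2 * t + 1)) / 2 := by
  rw [blockMean, sum_block_succ, blockMean, ← Finset.sum_div, div_div, pow_succ' (2 : ℝ)]

lemma blockMean_mono {l : ℕ} {G G' : ℕ → ℝ} (h : ∀ t, G t ≤ G' t) :
    blockMean l G ≤ blockMean l G' := by
  unfold blockMean
  gcongr
  exact h _

lemma blockMean_nonneg {l : ℕ} {G : ℕ → ℝ} (h : ∀ t, 0 ≤ G t) : 0 ≤ blockMean l G := by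
  have := blockMean_mono (l := l) h
  rwa [blockMean_const] at this

lemma blockMean_shift (l : ℕ) (G : ℕ → ℝ) (hG : ∀ t, G (2 * t) = G t) :
    blockMean l (fun t => G (t + 1)) = blockMean l G := by
  unfold blockMean
  rw [sum_block_shift G l (by rw [pow_succ', hG])]

/-- Real part of `charFn`. -/
def rePart (θ : ℝ) (t : ℕ) : ℝ := (charFn θ t).re

/-- Imaginary part of `charFn`. -/
def imPart (θ : ℝ) (t : ℕ) : ℝ := (charFn θ t).im

lemma rePart_two_mul (θ : ℝ) (t : ℕ) : rePart θ (2 * t) = rePart θ t := by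
  rw [rePart, charFn_two_mul, rePart]

lemma imPart_two_mul (θ : ℝ) (t : ℕ) : imPart θ (2 * t) = imPart θ t := by
  rw [imPart, charFn_two_mul, imPart]

lemma rePart_two_mul_add_one (θ : ℝ) {t : ℕ} (ht : 1 ≤ t) :
    rePart θ (2 * t + 1) = (Real.cos θ * (rePart θ t + rePart θ (t + 1))
      - Real.sin θ * (imPart θ t - imPart θ (t + 1))) / 2 := by
  simp only [rePart, imPart]
  rw [charFn_two_mul_add_one θ ht, show (2 : ℂ) = ((2 : ℝ) : ℂ) by simp, Complex.div_ofReal_re]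
  simp [phase_re, phase_im]
  ring

lemma imPart_two_mul_add_one (θ : ℝ) {t : ℕ} (ht : 1 ≤ t) :
    imPart θ (2 * t + 1) = (Real.cos θ * (imPart θ t + imPart θ (t + 1))
      + Real.sin θ * (rePart θ t - rePart θ (t + 1))) / 2 := by
  simp only [rePart, imPart]
  rw [charFn_two_mul_add_one θ ht, show (2 : ℂ) = ((2 : ℝ) : ℂ) by simp, Complex.div_ofReal_im]
  simp [phase_re, phase_im]
  ring

lemma rePart_one (θ : ℝ) : rePart θ 1 = 1 := by simp [rePart, charFn_one]

lemma imPart_one (θ : ℝ) : imPart θ 1 = 0 := by simp [imPart, charFn_one]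

lemma rePart_two (θ : ℝ) : rePart θ 2 = 1 := by
  have := rePart_two_mul θ 1
  rwa [mul_one, rePart_one] at this

lemma imPart_two (θ : ℝ) : imPart θ 2 = 0 := by
  have := imPart_two_mul θ 1
  rwa [mul_one, imPart_one] at this

/-- The average of p_{2t} and p_{2t+1} is p_t/2 + (e^{iθ}p_t + e^{-iθ}p_{t+1})/4. By shift
invariance, one level multiplies the mean by (1 + cos θ)/2. -/
lemma blockMean_rePart_imPart (θ : ℝ) (l : ℕ) :
    blockMean l (rePart θ) = ((1 + Real.cos θ) / 2) ^ l ∧ blockMean l (imPart θ) = 0 := by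
  induction l with
  | zero => simp [blockMean_zero, rePart_one, imPart_one]
  | succ l ih =>
    have hR := blockMean_shift l (rePart θ) (rePart_two_mul θ)
    have hI := blockMean_shift l (imPart θ) (imPart_two_mul θ)
    constructor
    · rw [blockMean_succ, blockMean_congr (G' := fun t => (1 / 2 + Real.cos θ / 4) * rePart θ t
        + (Real.cos θ / 4 * rePart θ (t + 1) + (-(Real.sin θ / 4) * imPart θ t
          + Real.sin θ / 4 * imPart θ (t + 1))))
        (fun t ht => by rw [rePart_two_mul, rePart_two_mul_add_one θ ht]; ring)]
      simp only [blockMean_add, blockMean_const_mul]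
      rw [hR, hI, ih.1, ih.2]
      ring
    · rw [blockMean_succ, blockMean_congr (G' := fun t => (1 / 2 + Real.cos θ / 4) * imPart θ t
        + (Real.cos θ / 4 * imPart θ (t + 1) + (Real.sin θ / 4 * rePart θ t
          + -(Real.sin θ / 4) * rePart θ (t + 1))))
        (fun t ht => by rw [imPart_two_mul, imPart_two_mul_add_one θ ht]; ring)]
      simp only [blockMean_add, blockMean_const_mul]
      rw [hR, hI, ih.1, ih.2]
      ring

/-- Mean of `(Im pₜ)²`. -/
def imSq (θ : ℝ) (l : ℕ) : ℝ := blockMean l fun t => imPart θ t * imPart θ t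

/-- Mean of `(Re pₜ)²`. -/
def reSq (θ : ℝ) (l : ℕ) : ℝ := blockMean l fun t => rePart θ t * rePart θ t

/-- Mean of `Im pₜ Im pₜ₊₁`. -/
def imCorr (θ : ℝ) (l : ℕ) : ℝ := blockMean l fun t => imPart θ t * imPart θ (t + 1)

/-- Mean of `Re pₜ Re pₜ₊₁`. -/
def reCorr (θ : ℝ) (l : ℕ) : ℝ := blockMean l fun t => rePart θ t * rePart θ (t + 1)

/-- Mean of `Im pₜ Re pₜ₊₁`. -/
def mixCorr (θ : ℝ) (l : ℕ) : ℝ := blockMean l fun t => imPart θ t * rePart θ (t + 1)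

/-- The mean of a quadratic form in `pₜ` and `pₜ₊₁`. -/
lemma blockMean_quad (θ : ℝ) (l : ℕ) (a₁ a₂ a₃ b₁ b₂ b₃ e₁ e₂ f g : ℝ) :
    blockMean l (fun t => a₁ * (imPart θ t * imPart θ t) + (a₂ * (imPart θ t * imPart θ (t + 1))
        + (a₃ * (imPart θ (t + 1) * imPart θ (t + 1)) + (b₁ * (rePart θ t * rePart θ t)
        + (b₂ * (rePart θ t * rePart θ (t + 1)) + (b₃ * (rePart θ (t + 1) * rePart θ (t + 1))
        + (e₁ * (rePart θ t * imPart θ t) + (e₂ * (rePart θ (t + 1) * imPart θ (t + 1))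
        + (f * (imPart θ t * rePart θ (t + 1)) + g * (rePart θ t * imPart θ (t + 1)))))))))))
      = (a₁ + a₃) * imSq θ l + a₂ * imCorr θ l + (b₁ + b₃) * reSq θ l + b₂ * reCorr θ l
        + (e₁ + e₂) * blockMean l (fun t => rePart θ t * imPart θ t) + f * mixCorr θ l
        + g * blockMean l (fun t => rePart θ t * imPart θ (t + 1)) := by
  simp only [blockMean_add, blockMean_const_mul]
  rw [blockMean_shift l (fun t => imPart θ t * imPart θ t) fun t => by simp only [imPart_two_mul],
    blockMean_shift l (fun t => rePart θ t * rePart θ t) fun t => by simp only [rePart_two_mul],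
    blockMean_shift l (fun t => rePart θ t * imPart θ t)
      fun t => by simp only [rePart_two_mul, imPart_two_mul]]
  simp only [imSq, reSq, imCorr, reCorr, mixCorr]
  ring

lemma imSq_zero (θ : ℝ) : imSq θ 0 = 0 := by simp [imSq, blockMean_zero, imPart_one]

lemma imCorr_zero (θ : ℝ) : imCorr θ 0 = 0 := by simp [imCorr, blockMean_zero, imPart_one]

lemma reSq_zero (θ : ℝ) : reSq θ 0 = 1 := by simp [reSq, blockMean_zero, rePart_one]

lemma reCorr_zero (θ : ℝ) : reCorr θ 0 = 1 := by
  simp [reCorr, blockMean_zero, rePart_one, rePart_two]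

lemma mixCorr_zero (θ : ℝ) : mixCorr θ 0 = 0 := by simp [mixCorr, blockMean_zero, imPart_one]

/-! ### Level recursions and positivity for the quadratic moments of (p_t, p_{t+1}). -/

section Recursion

variable (θ : ℝ) (l : ℕ)

/-- These identities express the symmetry t ↦ 3·2^l - t, which conjugates p_t; here they follow by a
joint induction. They let five moments form a closed system. -/
lemma blockMean_rePart_mul_imPart :
    blockMean l (fun t => rePart θ t * imPart θ t) = 0 ∧
      blockMean l (fun t => rePart θ t * imPart θ (t + 1)) = -mixCorr θ l := by
  induction l with
  | zero => simp [mixCorr, blockMean_zero, imPart_one, imPart_two, rePart_one]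
  | succ l ih =>
    set c := Real.cos θ
    set s := Real.sin θ
    have h1 : blockMean (l + 1) (fun t => rePart θ t * imPart θ t) = 0 := by
      rw [blockMean_succ]
      refine (blockMean_congr fun t ht => ?_).trans ((blockMean_quad θ l
        (-(c * s) / 8) 0 (c * s / 8) (c * s / 8) 0 (-(c * s) / 8)
        (1 / 2 + (c ^ 2 - s ^ 2) / 8) ((c ^ 2 - s ^ 2) / 8) ((c ^ 2 + s ^ 2) / 8)
        ((c ^ 2 + s ^ 2) / 8)).trans ?_)
      · rw [rePart_two_mul, imPart_two_mul, rePart_two_mul_add_one θ ht,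
          imPart_two_mul_add_one θ ht]
        ring
      · rw [ih.1, ih.2]; ring
    refine ⟨h1, ?_⟩
    rw [eq_neg_iff_add_eq_zero, mixCorr, ← blockMean_add, blockMean_succ]
    refine (blockMean_congr fun t ht => ?_).trans ((blockMean_quad θ l
      (-s / 4) 0 (s / 4) (s / 4) 0 (-s / 4) (c / 2) (c / 2) (c / 2) (c / 2)).trans ?_)
    · rw [show 2 * t + 1 + 1 = 2 * (t + 1) by ring]
      simp only [rePart_two_mul, imPart_two_mul, rePart_two_mul_add_one θ ht,
        imPart_two_mul_add_one θ ht]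
      ring
    · rw [ih.1, ih.2]; ring

lemma imSq_succ : imSq θ (l + 1) = imSq θ l / 2
    + Real.cos θ ^ 2 / 4 * (imSq θ l + imCorr θ l) + Real.sin θ ^ 2 / 4 * (reSq θ l - reCorr θ l)
    - Real.cos θ * Real.sin θ / 2 * mixCorr θ l := by
  set c := Real.cos θ
  set s := Real.sin θ
  rw [imSq, blockMean_succ]
  refine (blockMean_congr fun t ht => ?_).trans ((blockMean_quad θ l
    (1 / 2 + c ^ 2 / 8) (c ^ 2 / 4) (c ^ 2 / 8) (s ^ 2 / 8) (-(s ^ 2) / 4) (s ^ 2 / 8)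
    (c * s / 4) (-(c * s) / 4) (-(c * s) / 4) (c * s / 4)).trans ?_)
  · rw [imPart_two_mul, imPart_two_mul_add_one θ ht]
    ring
  · rw [(blockMean_rePart_mul_imPart θ l).1, (blockMean_rePart_mul_imPart θ l).2]; ring

lemma reSq_succ : reSq θ (l + 1) = reSq θ l / 2
    + Real.cos θ ^ 2 / 4 * (reSq θ l + reCorr θ l) + Real.sin θ ^ 2 / 4 * (imSq θ l - imCorr θ l)
    - Real.cos θ * Real.sin θ / 2 * mixCorr θ l := by
  set c := Real.cos θ
  set s := Real.sin θ
  rw [reSq, blockMean_succ]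
  refine (blockMean_congr fun t ht => ?_).trans ((blockMean_quad θ l
    (s ^ 2 / 8) (-(s ^ 2) / 4) (s ^ 2 / 8) (1 / 2 + c ^ 2 / 8) (c ^ 2 / 4) (c ^ 2 / 8)
    (-(c * s) / 4) (c * s / 4) (-(c * s) / 4) (c * s / 4)).trans ?_)
  · rw [rePart_two_mul, rePart_two_mul_add_one θ ht]
    ring
  · rw [(blockMean_rePart_mul_imPart θ l).1, (blockMean_rePart_mul_imPart θ l).2]; ring

lemma imCorr_succ : imCorr θ (l + 1) = Real.cos θ / 2 * (imSq θ l + imCorr θ l)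
    - Real.sin θ / 2 * mixCorr θ l := by
  set c := Real.cos θ
  set s := Real.sin θ
  rw [imCorr, blockMean_succ]
  refine (blockMean_congr fun t ht => ?_).trans ((blockMean_quad θ l
    (c / 4) (c / 2) (c / 4) 0 0 0 (s / 4) (-s / 4) (-s / 4) (s / 4)).trans ?_)
  · rw [show 2 * t + 1 + 1 = 2 * (t + 1) by ring]
    simp only [imPart_two_mul, imPart_two_mul_add_one θ ht]
    ring
  · rw [(blockMean_rePart_mul_imPart θ l).1, (blockMean_rePart_mul_imPart θ l).2]; ring

lemma reCorr_succ : reCorr θ (l + 1) = Real.cos θ / 2 * (reSq θ l + reCorr θ l)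
    - Real.sin θ / 2 * mixCorr θ l := by
  set c := Real.cos θ
  set s := Real.sin θ
  rw [reCorr, blockMean_succ]
  refine (blockMean_congr fun t ht => ?_).trans ((blockMean_quad θ l
    0 0 0 (c / 4) (c / 2) (c / 4) (-s / 4) (s / 4) (-s / 4) (s / 4)).trans ?_)
  · rw [show 2 * t + 1 + 1 = 2 * (t + 1) by ring]
    simp only [rePart_two_mul, rePart_two_mul_add_one θ ht]
    ring
  · rw [(blockMean_rePart_mul_imPart θ l).1, (blockMean_rePart_mul_imPart θ l).2]; ring

lemma mixCorr_succ : mixCorr θ (l + 1) = Real.cos θ / 2 * mixCorr θ l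
    - Real.sin θ / 4 * (imSq θ l - imCorr θ l + (reSq θ l - reCorr θ l)) := by
  set c := Real.cos θ
  set s := Real.sin θ
  rw [mixCorr, blockMean_succ]
  refine (blockMean_congr fun t ht => ?_).trans ((blockMean_quad θ l
    (-s / 4) (s / 4) 0 0 (s / 4) (-s / 4) (c / 4) (c / 4) (c / 2) 0).trans ?_)
  · rw [show 2 * t + 1 + 1 = 2 * (t + 1) by ring]
    simp only [imPart_two_mul, rePart_two_mul, rePart_two_mul_add_one θ ht,
      imPart_two_mul_add_one θ ht]
    ring
  · rw [(blockMean_rePart_mul_imPart θ l).1, (blockMean_rePart_mul_imPart θ l).2]; ring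

lemma imSq_nonneg : 0 ≤ imSq θ l := blockMean_nonneg fun _ => mul_self_nonneg _

lemma reSq_nonneg : 0 ≤ reSq θ l := blockMean_nonneg fun _ => mul_self_nonneg _

lemma imCorr_le : imCorr θ l ≤ imSq θ l := by
  have h : blockMean l (fun t => (imPart θ t - imPart θ (t + 1)) ^ 2) = _ :=
    (blockMean_congr fun t _ => by ring).trans (blockMean_quad θ l 1 (-2) 1 0 0 0 0 0 0 0)
  have h0 := (blockMean_nonneg fun _ => sq_nonneg _).trans h.le
  linarith

lemma reCorr_le : reCorr θ l ≤ reSq θ l := by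
  have h : blockMean l (fun t => (rePart θ t - rePart θ (t + 1)) ^ 2) = _ :=
    (blockMean_congr fun t _ => by ring).trans (blockMean_quad θ l 0 0 0 1 (-2) 1 0 0 0 0)
  have h0 := (blockMean_nonneg fun _ => sq_nonneg _).trans h.le
  linarith

/-- With u - iv = e^{-iα}, this is the nonnegativity of the block mean of |p_t - e^{-iα}p_{t+1}|².
-/
lemma rotated_corr_le {u v : ℝ} (huv : u ^ 2 + v ^ 2 = 1) :
    u * (imCorr θ l + reCorr θ l) - 2 * v * mixCorr θ l ≤ imSq θ l + reSq θ l := by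
  have h : blockMean l (fun t =>
      (imPart θ t - (u * imPart θ (t + 1) - v * rePart θ (t + 1))) ^ 2
      + (rePart θ t - (u * rePart θ (t + 1) + v * imPart θ (t + 1))) ^ 2) = _ :=
    (blockMean_congr fun t _ => by ring).trans (blockMean_quad θ l 1 (-2 * u) (u ^ 2 + v ^ 2)
      1 (-2 * u) (u ^ 2 + v ^ 2) 0 0 (2 * v) (-2 * v))
  have h0 := (blockMean_nonneg fun _ => by positivity).trans h.le
  rw [(blockMean_rePart_mul_imPart θ l).1, (blockMean_rePart_mul_imPart θ l).2, huv] at h0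
  linarith

lemma meanSq_succ_le : imSq θ (l + 1) + reSq θ (l + 1) ≤ imSq θ l + reSq θ l := by
  have h := Real.sin_sq_add_cos_sq θ
  have := rotated_corr_le θ l (u := Real.cos θ ^ 2 - Real.sin θ ^ 2)
    (v := 2 * Real.sin θ * Real.cos θ) (by
      rw [show (Real.cos θ ^ 2 - Real.sin θ ^ 2) ^ 2 + (2 * Real.sin θ * Real.cos θ) ^ 2
        = (Real.sin θ ^ 2 + Real.cos θ ^ 2) ^ 2 by ring, h]; norm_num)
  rw [imSq_succ, reSq_succ]
  linear_combination (1 / 4) * this + (imSq θ l + reSq θ l) / 4 * h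

/-- One level alone gives only monotonicity, from the rotation α = 2θ. After two levels, rotations
by both 2θ and 3θ occur along with the unrotated correlations, and this mismatch of angles gives a
strict contraction by 1 - h/4. -/
lemma meanSq_add_two_le : imSq θ (l + 1 + 1) + reSq θ (l + 1 + 1)
    ≤ (1 - (1 - Real.cos θ) / 8) * (imSq θ l + reSq θ l) := by
  have h := Real.sin_sq_add_cos_sq θ
  have h2 := rotated_corr_le θ l (u := Real.cos θ ^ 2 - Real.sin θ ^ 2)
    (v := 2 * Real.sin θ * Real.cos θ) (by
      rw [show (Real.cos θ ^ 2 - Real.sin θ ^ 2) ^ 2 + (2 * Real.sin θ * Real.cos θ) ^ 2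
        = (Real.sin θ ^ 2 + Real.cos θ ^ 2) ^ 2 by ring, h]; norm_num)
  have h3 := rotated_corr_le θ l (u := Real.cos θ ^ 3 - 3 * Real.cos θ * Real.sin θ ^ 2)
    (v := 3 * Real.sin θ * Real.cos θ ^ 2 - Real.sin θ ^ 3) (by
      rw [show (Real.cos θ ^ 3 - 3 * Real.cos θ * Real.sin θ ^ 2) ^ 2
        + (3 * Real.sin θ * Real.cos θ ^ 2 - Real.sin θ ^ 3) ^ 2
        = (Real.sin θ ^ 2 + Real.cos θ ^ 2) ^ 3 by ring, h]; norm_num)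
  rw [imSq_succ θ (l + 1), reSq_succ θ (l + 1), imSq_succ θ l, reSq_succ θ l, imCorr_succ,
    reCorr_succ, mixCorr_succ]
  have hs : Real.sin θ ^ 2 = 1 - Real.cos θ ^ 2 := by linarith
  have hs3 : Real.sin θ ^ 3 = (1 - Real.cos θ ^ 2) * Real.sin θ := by rw [← hs]; ring
  rw [hs] at h2 h3 ⊢
  rw [hs3] at h3
  generalize Real.cos θ = c at *
  generalize Real.sin θ = s at *
  linear_combination (3 / 16) * h2 + (1 / 8) * h3
    + c / 4 * (imSq θ l + reSq θ l - imCorr θ l - reCorr θ l) * hs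

end Recursion

/-! ### Decay of the second moments -/

/-- `(1 - cos θ)/2`. -/
def haverSin (θ : ℝ) : ℝ := (1 - Real.cos θ) / 2

/-- The decay rate of the second moments. -/
def decayRate (θ : ℝ) : ℝ := Real.sqrt (1 - haverSin θ / 4)

lemma haverSin_nonneg (θ : ℝ) : 0 ≤ haverSin θ := by
  unfold haverSin; linarith [Real.cos_le_one θ]

lemma haverSin_le_one (θ : ℝ) : haverSin θ ≤ 1 := by
  unfold haverSin; linarith [Real.neg_one_le_cos θ]

lemma haverSin_eq_sin_sq (θ : ℝ) : haverSin θ = Real.sin (θ / 2) ^ 2 := by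
  have h := Real.cos_two_mul (θ / 2)
  rw [show 2 * (θ / 2) = θ by ring] at h
  rw [haverSin, h, Real.cos_sq']
  ring

lemma decayRate_sq (θ : ℝ) : decayRate θ ^ 2 = 1 - haverSin θ / 4 :=
  Real.sq_sqrt (by linarith [haverSin_le_one θ])

lemma decayRate_le_one (θ : ℝ) : decayRate θ ≤ 1 :=
  Real.sqrt_le_one.2 (by linarith [haverSin_nonneg θ])

lemma three_quarters_le_decayRate (θ : ℝ) : 3 / 4 ≤ decayRate θ :=
  Real.le_sqrt_of_sq_le (by linarith [haverSin_le_one θ])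

lemma one_sub_haverSin_le_decayRate (θ : ℝ) : 1 - haverSin θ ≤ decayRate θ := by
  have h1 := decayRate_le_one θ
  have h2 := three_quarters_le_decayRate θ
  nlinarith [decayRate_sq θ, haverSin_nonneg θ]

/-- Iteration of the two-level contraction by ρ². The factor 2 covers l = 1, where the mean square
is at most 1 ≤ 2·(3/4). -/
lemma meanSq_le (θ : ℝ) (l : ℕ) : imSq θ l + reSq θ l ≤ 2 * decayRate θ ^ l := by
  have h0 : imSq θ 0 + reSq θ 0 = 1 := by rw [imSq_zero, reSq_zero]; norm_num
  induction l using Nat.twoStepInduction with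
  | zero => rw [h0]; norm_num
  | one =>
    have := meanSq_succ_le θ 0
    linarith [three_quarters_le_decayRate θ]
  | more l ih _ =>
    refine (meanSq_add_two_le θ l).trans ?_
    have h := decayRate_sq θ
    rw [haverSin] at h
    have h1 : 1 - (1 - Real.cos θ) / 8 = decayRate θ ^ 2 := by rw [h]; ring
    rw [h1, show l + 2 = 2 + l by ring, pow_add]
    nlinarith [sq_nonneg (decayRate θ)]

lemma sin_sq_eq_haverSin (θ : ℝ) : Real.sin θ ^ 2 = 4 * haverSin θ * (1 - haverSin θ) := by
  rw [haverSin, Real.sin_sq]; ring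

lemma cos_eq_haverSin (θ : ℝ) : Real.cos θ = 1 - 2 * haverSin θ := by
  rw [haverSin]; ring

/-- A sign, valid only when cos θ ≥ 0, that allows the mixed term to be dropped in `increments_le`.
For cos θ < 0, h ≥ 1/2 and the crude bound `meanSq_le` suffices later. -/
lemma mixCorr_nonpos {θ : ℝ} (hc : 0 ≤ Real.cos θ) (hs : 0 ≤ Real.sin θ) (l : ℕ) :
    mixCorr θ l ≤ 0 := by
  induction l with
  | zero => rw [mixCorr_zero]
  | succ l ih =>
    rw [mixCorr_succ]
    have h1 := mul_nonneg hs (sub_nonneg.2 (imCorr_le θ l))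
    have h2 := mul_nonneg hs (sub_nonneg.2 (reCorr_le θ l))
    nlinarith [mul_nonneg hc (neg_nonneg.2 ih)]

/-- The left side is half the block mean of |p_t - p_{t+1}|². It contracts by at least 1/2 and has
source at most 4h²ρ^l, so the constant 16 closes the induction: 8 + 4 = 16·(3/4) ≤ 16ρ. -/
lemma increments_le {θ : ℝ} (hc : 0 ≤ Real.cos θ) (hs : 0 ≤ Real.sin θ) (l : ℕ) :
    imSq θ l - imCorr θ l + (reSq θ l - reCorr θ l) ≤ 16 * haverSin θ ^ 2 * decayRate θ ^ l := by
  induction l with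
  | zero =>
    rw [imSq_zero, reSq_zero, imCorr_zero, reCorr_zero]
    have := haverSin_nonneg θ
    simp only [sub_self, add_zero, pow_zero, mul_one]
    positivity
  | succ l ih =>
    have hd := haverSin_nonneg θ
    have hk := mixCorr_nonpos hc hs l
    have hS := meanSq_le θ l
    have h1 := imCorr_le θ l
    have h2 := reCorr_le θ l
    have hg := three_quarters_le_decayRate θ
    have hg0 : 0 ≤ decayRate θ ^ l := pow_nonneg (by linarith) l
    have hs1 := Real.sin_sq_le_one θ
    have key : imSq θ (l + 1) - imCorr θ (l + 1) + (reSq θ (l + 1) - reCorr θ (l + 1))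
        = (1 / 4 - haverSin θ ^ 2 + Real.sin θ ^ 2 / 4)
            * (imSq θ l - imCorr θ l + (reSq θ l - reCorr θ l))
          + 2 * haverSin θ ^ 2 * (imSq θ l + reSq θ l)
          + 2 * haverSin θ * (Real.sin θ * mixCorr θ l) := by
      have h := sin_sq_eq_haverSin θ
      rw [imSq_succ, reSq_succ, imCorr_succ, reCorr_succ, cos_eq_haverSin θ, h]
      ring
    rw [key, pow_succ (decayRate θ) l]
    have e1 : 2 * haverSin θ * (Real.sin θ * mixCorr θ l) ≤ 0 :=
      mul_nonpos_of_nonneg_of_nonpos (by linarith) (mul_nonpos_of_nonneg_of_nonpos hs hk)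
    have e2 : (1 / 4 - haverSin θ ^ 2 + Real.sin θ ^ 2 / 4)
        * (imSq θ l - imCorr θ l + (reSq θ l - reCorr θ l))
        ≤ (1 / 2) * (imSq θ l - imCorr θ l + (reSq θ l - reCorr θ l)) :=
      mul_le_mul_of_nonneg_right (by nlinarith) (by linarith)
    have e3 : 2 * haverSin θ ^ 2 * (imSq θ l + reSq θ l)
        ≤ 2 * haverSin θ ^ 2 * (2 * decayRate θ ^ l) :=
      mul_le_mul_of_nonneg_left hS (by positivity)
    have e4 : 16 * haverSin θ ^ 2 * decayRate θ ^ l * (3 / 4)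
        ≤ 16 * haverSin θ ^ 2 * decayRate θ ^ l * decayRate θ :=
      mul_le_mul_of_nonneg_left hg (by positivity)
    linarith

lemma neg_mixCorr_le {θ : ℝ} (hc : 0 ≤ Real.cos θ) (hs : 0 ≤ Real.sin θ) (l : ℕ) :
    -mixCorr θ l ≤ 16 * Real.sin θ * haverSin θ ^ 2 * decayRate θ ^ l := by
  induction l with
  | zero =>
    rw [mixCorr_zero]
    simp only [neg_zero, pow_zero, mul_one]
    positivity
  | succ l ih =>
    have hk := mixCorr_nonpos hc hs l
    have hM := mul_le_mul_of_nonneg_left (increments_le hc hs l) hs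
    have hg := three_quarters_le_decayRate θ
    have hg0 : 0 ≤ decayRate θ ^ l := pow_nonneg (by linarith) l
    have e4 : 16 * Real.sin θ * haverSin θ ^ 2 * decayRate θ ^ l * (3 / 4)
        ≤ 16 * Real.sin θ * haverSin θ ^ 2 * decayRate θ ^ l * decayRate θ :=
      mul_le_mul_of_nonneg_left hg (by positivity)
    have e5 : Real.cos θ * -mixCorr θ l ≤ 1 * -mixCorr θ l :=
      mul_le_mul_of_nonneg_right (Real.cos_le_one θ) (by linarith)
    rw [mixCorr_succ, pow_succ (decayRate θ) l]
    linarith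

/-- The mixed source term in the recursions for `imSq` and `reSq`. -/
lemma source_le {θ : ℝ} (hc : 0 ≤ Real.cos θ) (hs : 0 ≤ Real.sin θ) (l : ℕ) :
    -(Real.cos θ * Real.sin θ / 2 * mixCorr θ l)
      ≤ 8 * Real.sin θ ^ 2 * haverSin θ ^ 2 * decayRate θ ^ l := by
  have hk := neg_mixCorr_le hc hs l
  have hk0 := mixCorr_nonpos hc hs l
  have e : Real.cos θ * (Real.sin θ * -mixCorr θ l) ≤ 1 * (Real.sin θ * -mixCorr θ l) :=
    mul_le_mul_of_nonneg_right (Real.cos_le_one θ) (mul_nonneg hs (by linarith))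
  have := mul_le_mul_of_nonneg_left hk hs
  linarith

/-- The homogeneous factor (1 + cos²θ)/2 is at most ρ, and the sources are 4 + 8 = 12 times sin²θ h²
ρ^l, with 12 = 16·(3/4) ≤ 16ρ. Each level adds one such term, hence the factor l. -/
lemma imSq_le_of_cos_nonneg {θ : ℝ} (hc : 0 ≤ Real.cos θ) (hs : 0 ≤ Real.sin θ) (l : ℕ) :
    imSq θ l ≤ 16 * l * (Real.sin θ ^ 2 * haverSin θ ^ 2) * decayRate θ ^ l := by
  induction l with
  | zero => rw [imSq_zero]; simp
  | succ l ih =>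
    have hg := three_quarters_le_decayRate θ
    have hg0 : 0 ≤ decayRate θ ^ l := pow_nonneg (by linarith) l
    have h1 := imCorr_le θ l
    have h2 := reCorr_le θ l
    have hM := increments_le hc hs l
    have hsrc := source_le hc hs l
    have hd := haverSin_nonneg θ
    have e1 : Real.cos θ ^ 2 / 4 * (imSq θ l + imCorr θ l)
        ≤ Real.cos θ ^ 2 / 4 * (2 * imSq θ l) :=
      mul_le_mul_of_nonneg_left (by linarith) (by positivity)
    have e2 : Real.sin θ ^ 2 / 4 * (reSq θ l - reCorr θ l)
        ≤ Real.sin θ ^ 2 / 4 * (16 * haverSin θ ^ 2 * decayRate θ ^ l) :=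
      mul_le_mul_of_nonneg_left (by linarith) (by positivity)
    have e3 : (1 / 2 + Real.cos θ ^ 2 / 2) * imSq θ l ≤ decayRate θ * imSq θ l := by
      refine mul_le_mul_of_nonneg_right ?_ (imSq_nonneg θ l)
      have := one_sub_haverSin_le_decayRate θ
      unfold haverSin at this
      nlinarith [Real.cos_le_one θ]
    have e4 := mul_le_mul_of_nonneg_left ih (by linarith : 0 ≤ decayRate θ)
    have e5 : 16 * (Real.sin θ ^ 2 * haverSin θ ^ 2) * decayRate θ ^ l * (3 / 4)
        ≤ 16 * (Real.sin θ ^ 2 * haverSin θ ^ 2) * decayRate θ ^ l * decayRate θ :=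
      mul_le_mul_of_nonneg_left hg (by positivity)
    rw [imSq_succ, pow_succ (decayRate θ) l]
    push_cast
    linarith

/-- Since (1 + cos²θ)/2 = (1-h)² + h², subtracting the squared mean leaves the factor (1-h)² ≤ ρ and
an extra source h²·`reSq θ l` ≤ 2h²ρ^l. The sources total at most 14h²ρ^l, and 14 ≤ 19·(3/4). -/
lemma reVar_le_of_cos_nonneg {θ : ℝ} (hc : 0 ≤ Real.cos θ) (hs : 0 ≤ Real.sin θ) (l : ℕ)
    (hw : ∀ l, ((1 - haverSin θ) ^ l) ^ 2 ≤ reSq θ l) :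
    reSq θ l - ((1 - haverSin θ) ^ l) ^ 2 ≤ 19 * l * haverSin θ ^ 2 * decayRate θ ^ l := by
  induction l with
  | zero => rw [reSq_zero]; simp
  | succ l ih =>
    have hg := three_quarters_le_decayRate θ
    have hg0 : 0 ≤ decayRate θ ^ l := pow_nonneg (by linarith) l
    have h1 := imCorr_le θ l
    have h2 := reCorr_le θ l
    have hM := increments_le hc hs l
    have hsrc := source_le hc hs l
    have hd := haverSin_nonneg θ
    have hd1 := haverSin_le_one θ
    have hS := meanSq_le θ l
    have hI := imSq_nonneg θ l
    have hs1 := Real.sin_sq_le_one θ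
    have hX : 0 ≤ haverSin θ ^ 2 * decayRate θ ^ l := by positivity
    have e1 : Real.cos θ ^ 2 / 4 * (reSq θ l + reCorr θ l)
        ≤ Real.cos θ ^ 2 / 4 * (2 * reSq θ l) :=
      mul_le_mul_of_nonneg_left (by linarith) (by positivity)
    have e2 : Real.sin θ ^ 2 / 4 * (imSq θ l - imCorr θ l)
        ≤ Real.sin θ ^ 2 / 4 * (16 * haverSin θ ^ 2 * decayRate θ ^ l) :=
      mul_le_mul_of_nonneg_left (by linarith) (by positivity)
    have e3 : (1 / 2 + Real.cos θ ^ 2 / 2) = (1 - haverSin θ) ^ 2 + haverSin θ ^ 2 := by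
      rw [cos_eq_haverSin]; ring
    have e4 : (1 - haverSin θ) ^ 2 * (reSq θ l - ((1 - haverSin θ) ^ l) ^ 2)
        ≤ decayRate θ * (reSq θ l - ((1 - haverSin θ) ^ l) ^ 2) := by
      refine mul_le_mul_of_nonneg_right ?_ (by linarith [hw l])
      have := one_sub_haverSin_le_decayRate θ
      nlinarith
    have e5 := mul_le_mul_of_nonneg_left ih (by linarith : 0 ≤ decayRate θ)
    have e6 : haverSin θ ^ 2 * reSq θ l ≤ haverSin θ ^ 2 * (2 * decayRate θ ^ l) :=
      mul_le_mul_of_nonneg_left (by linarith) (by positivity)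
    have e7 : Real.sin θ ^ 2 * (haverSin θ ^ 2 * decayRate θ ^ l)
        ≤ 1 * (haverSin θ ^ 2 * decayRate θ ^ l) := mul_le_mul_of_nonneg_right hs1 hX
    have e8 : 19 * (haverSin θ ^ 2 * decayRate θ ^ l) * (3 / 4)
        ≤ 19 * (haverSin θ ^ 2 * decayRate θ ^ l) * decayRate θ :=
      mul_le_mul_of_nonneg_left hg (by positivity)
    have e9 : reSq θ l / 2 + Real.cos θ ^ 2 / 4 * (2 * reSq θ l)
        = (1 - haverSin θ) ^ 2 * reSq θ l + haverSin θ ^ 2 * reSq θ l := by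
      linear_combination reSq θ l * e3
    rw [reSq_succ, pow_succ (decayRate θ) l, pow_succ (1 - haverSin θ) l]
    push_cast
    rw [mul_pow]
    linarith

/-- The variance over the block of `Re pₜ`. -/
def reVar (θ : ℝ) (l : ℕ) : ℝ :=
  blockMean l fun t => (rePart θ t - (1 - haverSin θ) ^ l) ^ 2

lemma blockMean_rePart (θ : ℝ) (l : ℕ) : blockMean l (rePart θ) = (1 - haverSin θ) ^ l := by
  rw [(blockMean_rePart_imPart θ l).1, haverSin]
  congr 1
  ring

lemma reVar_eq (θ : ℝ) (l : ℕ) : reVar θ l = reSq θ l - ((1 - haverSin θ) ^ l) ^ 2 := by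
  have h : reVar θ l = blockMean l (fun t => rePart θ t * rePart θ t
      + (-2 * (1 - haverSin θ) ^ l * rePart θ t + ((1 - haverSin θ) ^ l) ^ 2)) :=
    blockMean_congr fun t _ => by ring
  rw [h, blockMean_add, blockMean_add, blockMean_const_mul, blockMean_const, blockMean_rePart,
    reSq]
  ring

lemma reVar_le {θ : ℝ} (hs : 0 ≤ Real.sin θ) (l : ℕ) :
    reVar θ l ≤ 19 * (l + 1) * haverSin θ ^ 2 * decayRate θ ^ l := by
  have hg := three_quarters_le_decayRate θ
  have hg0 : 0 ≤ decayRate θ ^ l := pow_nonneg (by linarith) l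
  have hX : 0 ≤ haverSin θ ^ 2 * decayRate θ ^ l := by positivity
  rcases le_or_gt 0 (Real.cos θ) with hc | hc
  · rw [reVar_eq]
    refine (reVar_le_of_cos_nonneg hc hs l fun l => ?_).trans (by linarith)
    have : 0 ≤ reVar θ l := blockMean_nonneg fun _ => sq_nonneg _
    rw [reVar_eq] at this
    linarith
  · have h1 := meanSq_le θ l
    have h2 := imSq_nonneg θ l
    have hd : 1 / 2 ≤ haverSin θ := by unfold haverSin; linarith
    have h4 : (1 / 4) * decayRate θ ^ l ≤ haverSin θ ^ 2 * decayRate θ ^ l :=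
      mul_le_mul_of_nonneg_right (by nlinarith) hg0
    have h5 : 0 ≤ (l : ℝ) * (haverSin θ ^ 2 * decayRate θ ^ l) := by positivity
    rw [reVar_eq]
    nlinarith [sq_nonneg ((1 - haverSin θ) ^ l)]

/-- For cos θ ≥ 0, sin²θ = 4h(1-h) supplies the third power of h and the constant 64 = 16·4. For cos
θ < 0, h³ is bounded below. -/
lemma imSq_le {θ : ℝ} (hs : 0 ≤ Real.sin θ) (l : ℕ) :
    imSq θ l ≤ 64 * (l + 1) * haverSin θ ^ 3 * decayRate θ ^ l := by
  have hg := three_quarters_le_decayRate θ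
  have hg0 : 0 ≤ decayRate θ ^ l := pow_nonneg (by linarith) l
  have hd0 := haverSin_nonneg θ
  have hX : 0 ≤ haverSin θ ^ 3 * decayRate θ ^ l := by positivity
  have h5 : 0 ≤ (l : ℝ) * (haverSin θ ^ 3 * decayRate θ ^ l) := by positivity
  rcases le_or_gt 0 (Real.cos θ) with hc | hc
  · refine (imSq_le_of_cos_nonneg hc hs l).trans ?_
    have h : Real.sin θ ^ 2 * haverSin θ ^ 2 ≤ 4 * haverSin θ ^ 3 := by
      rw [sin_sq_eq_haverSin]
      nlinarith [pow_nonneg hd0 4]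
    have := mul_le_mul_of_nonneg_left h (by positivity : 0 ≤ 16 * (l : ℝ) * decayRate θ ^ l)
    linarith
  · have h1 := meanSq_le θ l
    have h2 := reSq_nonneg θ l
    have hd : 1 / 2 ≤ haverSin θ := by unfold haverSin; linarith
    have h3 : (1 / 2 : ℝ) ^ 3 ≤ haverSin θ ^ 3 := by gcongr
    have h4 : (1 / 2 : ℝ) ^ 3 * decayRate θ ^ l ≤ haverSin θ ^ 3 * decayRate θ ^ l :=
      mul_le_mul_of_nonneg_right h3 hg0
    linarith

/-! ### Gaussian estimates -/

lemma sq_div_pi_sq_le_haverSin {θ : ℝ} (h0 : 0 ≤ θ) (h1 : θ ≤ Real.pi) :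
    θ ^ 2 / Real.pi ^ 2 ≤ haverSin θ := by
  have hp := Real.pi_pos
  have h := Real.mul_le_sin (x := θ / 2) (by linarith) (by linarith)
  rw [haverSin_eq_sin_sq, ← div_pow]
  rw [show 2 / Real.pi * (θ / 2) = θ / Real.pi by ring] at h
  gcongr

lemma continuous_haverSin : Continuous haverSin := by
  unfold haverSin
  fun_prop

lemma continuous_decayRate : Continuous decayRate := by
  unfold decayRate
  exact (continuous_const.sub (continuous_haverSin.div_const _)).sqrt

lemma integral_exp_haverSin_le {l : ℕ} (hl : 1 ≤ l) :
    ∫ θ in (0 : ℝ)..Real.pi, Real.exp (-(l * haverSin θ / 16))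
      ≤ Real.sqrt (16 * Real.pi ^ 3) / Real.sqrt l := by
  have hp := Real.pi_pos
  have hl' : (0 : ℝ) < l := by exact_mod_cast hl
  have hb : 0 < (l : ℝ) / (16 * Real.pi ^ 2) := by positivity
  have hgi := integrable_exp_neg_mul_sq hb
  calc ∫ θ in (0 : ℝ)..Real.pi, Real.exp (-(l * haverSin θ / 16))
      ≤ ∫ θ in (0 : ℝ)..Real.pi, Real.exp (-(l / (16 * Real.pi ^ 2)) * θ ^ 2) := by
        refine intervalIntegral.integral_mono_on hp.le
          (Continuous.intervalIntegrable (by have := continuous_haverSin; fun_prop) _ _)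
          (Continuous.intervalIntegrable (by fun_prop) _ _) fun θ hθ => ?_
        rw [Real.exp_le_exp]
        have := sq_div_pi_sq_le_haverSin hθ.1 hθ.2
        have h2 : (l : ℝ) / 16 * (θ ^ 2 / Real.pi ^ 2) ≤ l / 16 * haverSin θ := by gcongr
        calc _ = -(l / 16 * haverSin θ) := by ring
          _ ≤ -(l / 16 * (θ ^ 2 / Real.pi ^ 2)) := by linarith
          _ = _ := by field_simp
    _ ≤ ∫ θ : ℝ, Real.exp (-(l / (16 * Real.pi ^ 2)) * θ ^ 2) := by
        rw [intervalIntegral.integral_of_le hp.le]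
        exact setIntegral_le_integral hgi (Eventually.of_forall fun θ => (Real.exp_pos _).le)
    _ = Real.sqrt (16 * Real.pi ^ 3) / Real.sqrt l := by
        rw [integral_gaussian, ← Real.sqrt_div (by positivity)]
        congr 1
        field_simp

/-- From ρ ≤ e^{-h/8}: half of the exponent absorbs h² by x²/2 ≤ e^x at x = lh/16, whence 512 =
2·16², and half is kept for the Gaussian integral. -/
lemma haverSin_sq_mul_decayRate_pow_le (θ : ℝ) {l : ℕ} (hl : 1 ≤ l) :
    haverSin θ ^ 2 * decayRate θ ^ l ≤ 512 / l ^ 2 * Real.exp (-(l * haverSin θ / 16)) := by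
  have hl' : (0 : ℝ) < l := by exact_mod_cast hl
  have hd := haverSin_nonneg θ
  have h1 : decayRate θ ≤ Real.exp (-(haverSin θ / 8)) := by
    refine Real.sqrt_le_iff.2 ⟨(Real.exp_pos _).le, ?_⟩
    rw [← Real.exp_nat_mul]
    have := Real.add_one_le_exp (-(haverSin θ / 4))
    refine le_trans (by linarith) (this.trans (Real.exp_le_exp.2 (le_of_eq ?_)))
    push_cast
    ring
  have h2 : decayRate θ ^ l ≤ Real.exp (-(l * haverSin θ / 8)) := by
    refine (pow_le_pow_left₀ (Real.sqrt_nonneg _) h1 l).trans (le_of_eq ?_)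
    rw [← Real.exp_nat_mul]
    congr 1
    ring
  have h3 : (l * haverSin θ / 16) ^ 2 / 2 ≤ Real.exp (l * haverSin θ / 16) := by
    have := Real.quadratic_le_exp_of_nonneg (x := l * haverSin θ / 16) (by positivity)
    have h0 : 0 ≤ l * haverSin θ / 16 := by positivity
    linarith
  have h4 : haverSin θ ^ 2 ≤ 512 / l ^ 2 * Real.exp (l * haverSin θ / 16) := by
    rw [div_mul_eq_mul_div, le_div_iff₀ (by positivity)]
    nlinarith
  calc haverSin θ ^ 2 * decayRate θ ^ l
      ≤ (512 / l ^ 2 * Real.exp (l * haverSin θ / 16)) * Real.exp (-(l * haverSin θ / 8)) := by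
        gcongr
        exact pow_nonneg (Real.sqrt_nonneg _) l
    _ = 512 / l ^ 2 * Real.exp (-(l * haverSin θ / 16)) := by
        rw [mul_assoc, ← Real.exp_add]
        congr 2
        ring

lemma haverSin_mul_one_sub_pow_le (θ : ℝ) {l : ℕ} (hl : 1 ≤ l) :
    haverSin θ * (1 - haverSin θ) ^ l ≤ 2 / l * Real.exp (-(l * haverSin θ / 16)) := by
  have hl' : (0 : ℝ) < l := by exact_mod_cast hl
  have hd := haverSin_nonneg θ
  have hd1 := haverSin_le_one θ
  have h2 : (1 - haverSin θ) ^ l ≤ Real.exp (-(l * haverSin θ)) := by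
    refine (pow_le_pow_left₀ (by linarith) (Real.one_sub_le_exp_neg _) l).trans (le_of_eq ?_)
    rw [← Real.exp_nat_mul]
    congr 1
    ring
  have h4 : haverSin θ ≤ 2 / l * Real.exp (15 * (l * haverSin θ) / 16) := by
    rw [div_mul_eq_mul_div, le_div_iff₀ (by positivity)]
    have := Real.add_one_le_exp (15 * (l * haverSin θ) / 16)
    have h0 : 0 ≤ l * haverSin θ := by positivity
    linarith
  calc haverSin θ * (1 - haverSin θ) ^ l
      ≤ (2 / l * Real.exp (15 * (l * haverSin θ) / 16)) * Real.exp (-(l * haverSin θ)) := by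
        gcongr
    _ = 2 / l * Real.exp (-(l * haverSin θ / 16)) := by
        rw [mul_assoc, ← Real.exp_add]
        congr 2
        ring

lemma integral_haverSin_sq_mul_decayRate_pow_le {l : ℕ} (hl : 1 ≤ l) :
    ∫ θ in (0 : ℝ)..Real.pi, haverSin θ ^ 2 * decayRate θ ^ l
      ≤ 512 / l ^ 2 * (Real.sqrt (16 * Real.pi ^ 3) / Real.sqrt l) := by
  have h1 := continuous_haverSin
  have h2 := continuous_decayRate
  calc _ ≤ ∫ θ in (0 : ℝ)..Real.pi, 512 / (l : ℝ) ^ 2 * Real.exp (-(l * haverSin θ / 16)) :=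
        intervalIntegral.integral_mono_on Real.pi_pos.le
          (Continuous.intervalIntegrable (by fun_prop) _ _)
          (Continuous.intervalIntegrable (by fun_prop) _ _)
          fun θ _ => haverSin_sq_mul_decayRate_pow_le θ hl
    _ ≤ _ := by
        rw [intervalIntegral.integral_const_mul]
        gcongr
        exact integral_exp_haverSin_le hl

lemma integral_haverSin_mul_one_sub_pow_le {l : ℕ} (hl : 1 ≤ l) :
    ∫ θ in (0 : ℝ)..Real.pi, haverSin θ * (1 - haverSin θ) ^ l
      ≤ 2 / l * (Real.sqrt (16 * Real.pi ^ 3) / Real.sqrt l) := by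
  have h1 := continuous_haverSin
  calc _ ≤ ∫ θ in (0 : ℝ)..Real.pi, 2 / (l : ℝ) * Real.exp (-(l * haverSin θ / 16)) :=
        intervalIntegral.integral_mono_on Real.pi_pos.le
          (Continuous.intervalIntegrable (by fun_prop) _ _)
          (Continuous.intervalIntegrable (by fun_prop) _ _)
          fun θ _ => haverSin_mul_one_sub_pow_le θ hl
    _ ≤ _ := by
        rw [intervalIntegral.integral_const_mul]
        gcongr
        exact integral_exp_haverSin_le hl

/-! ### The central term -/

/-- The normalized central binomial coefficient as an integral. -/
def centralMass (l : ℕ) : ℝ := (1 / Real.pi) * ∫ θ in (0 : ℝ)..Real.pi, (1 - haverSin θ) ^ l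

lemma centralMass_eq_prod (l : ℕ) :
    centralMass l = ∏ i ∈ Finset.range l, ((2 : ℝ) * i + 1) / (2 * i + 2) := by
  have h1 : ∀ θ, (1 - haverSin θ) ^ l = Real.cos (θ / 2) ^ (2 * l) := by
    intro θ
    rw [haverSin_eq_sin_sq, pow_mul, Real.cos_sq']
  rw [centralMass]
  simp only [h1]
  rw [intervalIntegral.integral_comp_div (fun u => Real.cos u ^ (2 * l)) two_ne_zero, zero_div,
    EulerSine.integral_cos_pow_eq, integral_sin_pow_even]
  have := Real.pi_pos.ne'
  rw [smul_eq_mul]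
  field_simp

lemma centralMass_sq_mul_W (l : ℕ) :
    centralMass l ^ 2 * (Real.Wallis.W l * (2 * l + 1)) = 1 := by
  rw [centralMass_eq_prod]
  induction l with
  | zero => simp [Real.Wallis.W]
  | succ l ih =>
    rw [Finset.prod_range_succ, Real.Wallis.W_succ]
    push_cast
    generalize ∏ i ∈ Finset.range l, ((2 : ℝ) * i + 1) / (2 * i + 2) = P at *
    generalize Real.Wallis.W l = W at *
    field_simp
    linear_combination (2 * l + 3) * ih

lemma centralMass_pos (l : ℕ) : 0 < centralMass l := by
  rw [centralMass_eq_prod]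
  exact Finset.prod_pos fun i _ => by positivity

/-- The bounds (2l+1)/(2l+2)·π/2 ≤ W ≤ π/2 on the Wallis product confine the square to within a
relative error 1/l of 1/(πl), from below. -/
lemma abs_centralMass_sub_le {l : ℕ} (hl : 1 ≤ l) :
    |centralMass l - 1 / Real.sqrt (Real.pi * l)| ≤ 1 / (l * Real.sqrt l) := by
  have hp := Real.pi_pos
  have hl' : (1 : ℝ) ≤ l := by exact_mod_cast hl
  have hW := Real.Wallis.W_pos l
  have h1 := Real.Wallis.W_le l
  have h2 := Real.Wallis.le_W l
  have hsq : centralMass l ^ 2 = 1 / (Real.Wallis.W l * (2 * l + 1)) := by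
    rw [eq_div_iff (by positivity)]
    exact centralMass_sq_mul_W l
  have hb := centralMass_pos l
  set r := 1 / Real.sqrt (Real.pi * l) with hr
  have hr0 : 0 < r := by positivity
  have hr2 : r ^ 2 = 1 / (Real.pi * l) := by
    rw [hr, div_pow, Real.sq_sqrt (by positivity), one_pow]
  have hup : centralMass l ^ 2 ≤ r ^ 2 := by
    rw [hsq, hr2]
    refine one_div_le_one_div_of_le (by positivity) ?_
    calc Real.pi * l ≤ (2 * l + 1) / (2 * l + 2) * (Real.pi / 2) * (2 * l + 1) := by
          rw [div_mul_eq_mul_div, div_mul_eq_mul_div, le_div_iff₀ (by positivity)]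
          nlinarith
      _ ≤ _ := by gcongr
  have hlow : r ^ 2 - centralMass l ^ 2 ≤ 1 / (Real.pi * l) * (1 / l) := by
    have : 1 / (Real.pi / 2 * (2 * l + 1)) ≤ centralMass l ^ 2 := by
      rw [hsq]
      exact one_div_le_one_div_of_le (by positivity) (by gcongr)
    rw [hr2]
    have e : 1 / (Real.pi * l) - 1 / (Real.pi * l) * (1 / l)
        ≤ 1 / (Real.pi / 2 * (2 * l + 1)) := by
      rw [div_mul_div_comm, div_sub_div _ _ (by positivity) (by positivity),
        div_le_div_iff₀ (by positivity) (by positivity)]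
      have : 0 ≤ Real.pi ^ 2 * (l : ℝ) := by positivity
      nlinarith
    linarith
  have hle : centralMass l ≤ r := by
    exact (sq_le_sq₀ hb.le hr0.le).1 hup
  have hlow' : (r - centralMass l) * r ≤ r ^ 2 * (1 / l) := by
    rw [hr2]
    nlinarith
  have h5 : r - centralMass l ≤ r * (1 / l) := by
    have : (r - centralMass l) * r ≤ (r * (1 / l)) * r := by linarith
    exact le_of_mul_le_mul_right this hr0
  rw [abs_sub_comm, abs_of_nonneg (by linarith)]
  refine h5.trans ?_
  rw [hr, div_mul_div_comm, one_mul]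
  refine one_div_le_one_div_of_le (by positivity) ?_
  rw [mul_comm]
  gcongr
  nlinarith [Real.pi_gt_three]

/-! ### Mean and variance of the tail densities over a dyadic block -/

/-- The factor `e^{-imθ}` times the characteristic function for `t = 1`. -/
def twist (m : ℤ) (θ : ℝ) : ℂ := charFnOne θ * phase θ (-m)

lemma admissible_twist (m : ℤ) : Admissible (twist m) :=
  admissible_charFnOne.mul (admissible_phase _)

/-- The mean of `tailDens m` over the block of level `l`. -/
def tailMean (m : ℤ) (l : ℕ) : ℝ :=
  tailFunctional fun θ => (((1 - haverSin θ) ^ l : ℝ) : ℂ) * twist m θ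

/-- The integrand of the deviation of `tailDens m t` from its block mean. -/
def deviation (m : ℤ) (l t : ℕ) (θ : ℝ) : ℝ :=
  cotPair θ (twist m θ * (charFn θ t + ((-(1 - haverSin θ) ^ l : ℝ) : ℂ)))

lemma abs_one_sub_haverSin_pow_le (θ : ℝ) (l : ℕ) : |(1 - haverSin θ) ^ l| ≤ 1 := by
  have h1 := haverSin_nonneg θ
  have h2 := haverSin_le_one θ
  rw [abs_of_nonneg (pow_nonneg (by linarith) l)]
  exact pow_le_one₀ (by linarith) (by linarith)

lemma continuous_one_sub_haverSin_pow (l : ℕ) : Continuous fun θ => (1 - haverSin θ) ^ l :=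
  (continuous_const.sub continuous_haverSin).pow l

lemma admissible_mean (m : ℤ) (l : ℕ) :
    Admissible fun θ => (((1 - haverSin θ) ^ l : ℝ) : ℂ) * twist m θ :=
  (Admissible.ofReal (continuous_one_sub_haverSin_pow l)
    (fun θ => abs_one_sub_haverSin_pow_le θ l)).mul (admissible_twist m)

lemma admissible_deviation (m : ℤ) (l t : ℕ) :
    Admissible fun θ => twist m θ * (charFn θ t + ((-(1 - haverSin θ) ^ l : ℝ) : ℂ)) :=
  (admissible_twist m).mul ((admissible_charFn t).add
    (Admissible.ofReal (continuous_one_sub_haverSin_pow l).neg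
      (fun θ => (abs_neg _).trans_le (abs_one_sub_haverSin_pow_le θ l))))

lemma intervalIntegrable_deviation (m : ℤ) (l t : ℕ) :
    IntervalIntegrable (fun θ => deviation m l t θ) volume 0 Real.pi :=
  (admissible_deviation m l t).intervalIntegrable _ _

lemma tailDens_sub_tailMean (m : ℤ) (l : ℕ) {t : ℕ} (ht : 1 ≤ t) :
    tailDens m t - tailMean m l
      = (1 / (2 * Real.pi)) * ∫ θ in (0 : ℝ)..Real.pi, deviation m l t θ := by
  have h : ∀ θ, cotPair θ (charFnOne θ * charFn θ t * phase θ (-m))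
      = deviation m l t θ + cotPair θ ((((1 - haverSin θ) ^ l : ℝ) : ℂ) * twist m θ) := by
    intro θ
    rw [deviation, ← cotPair_add, twist]
    congr 1
    push_cast
    ring
  rw [tailDens_eq_tailFunctional m ht, tailFunctional, tailMean, tailFunctional]
  simp only [h]
  rw [intervalIntegral.integral_add (intervalIntegrable_deviation m l t)
    ((admissible_mean m l).intervalIntegrable _ _)]
  ring

/-- `cotPair θ` is only real-linear, so real and imaginary parts of p_t enter with different
kernels. -/
lemma deviation_eq (m : ℤ) (l t : ℕ) (θ : ℝ) : deviation m l t θ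
    = cotPair θ (twist m θ) * (rePart θ t - (1 - haverSin θ) ^ l)
      + cotPair θ (twist m θ * Complex.I) * imPart θ t := by
  simp only [deviation, cotPair, rePart, imPart, Complex.mul_re, Complex.mul_im, Complex.add_re,
    Complex.add_im, Complex.ofReal_re, Complex.ofReal_im, Complex.I_re, Complex.I_im]
  ring

lemma blockMean_deviation (m : ℤ) (l : ℕ) (θ : ℝ) :
    blockMean l (fun t => deviation m l t θ) = 0 := by
  have h : blockMean l (fun t => deviation m l t θ)
      = blockMean l fun t => cotPair θ (twist m θ) * rePart θ t
        + (-(cotPair θ (twist m θ) * (1 - haverSin θ) ^ l)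
          + cotPair θ (twist m θ * Complex.I) * imPart θ t) :=
    blockMean_congr fun t _ => by rw [deviation_eq]; ring
  rw [h, blockMean_add, blockMean_add, blockMean_const_mul, blockMean_const, blockMean_const_mul,
    blockMean_rePart, (blockMean_rePart_imPart θ l).2]
  ring

lemma blockMean_integral {h : ℕ → ℝ → ℝ} (l : ℕ)
    (hh : ∀ t, IntervalIntegrable (h t) volume 0 Real.pi) :
    blockMean l (fun t => ∫ θ in (0 : ℝ)..Real.pi, h t θ)
      = ∫ θ in (0 : ℝ)..Real.pi, blockMean l (fun t => h t θ) := by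
  unfold blockMean
  rw [intervalIntegral.integral_div, intervalIntegral.integral_finsetSum fun t _ => hh t]

lemma blockMean_tailDens_sub (m : ℤ) (l : ℕ) :
    blockMean l (fun t => tailDens m t - tailMean m l) = 0 := by
  rw [blockMean_congr fun t ht => tailDens_sub_tailMean m l ht, blockMean_const_mul,
    blockMean_integral l (intervalIntegrable_deviation m l)]
  simp [blockMean_deviation]

/-- Cauchy–Schwarz, from nonnegativity of the variance of `h` about its mean on [0,π]. -/
lemma sq_integral_le {h : ℝ → ℝ} (h1 : IntervalIntegrable h volume 0 Real.pi)
    (h2 : IntervalIntegrable (fun θ => h θ ^ 2) volume 0 Real.pi) :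
    (∫ θ in (0 : ℝ)..Real.pi, h θ) ^ 2 ≤ Real.pi * ∫ θ in (0 : ℝ)..Real.pi, h θ ^ 2 := by
  have hp := Real.pi_pos
  set a := (∫ θ in (0 : ℝ)..Real.pi, h θ) / Real.pi with ha
  have h3 : 0 ≤ ∫ θ in (0 : ℝ)..Real.pi, (h θ - a) ^ 2 :=
    intervalIntegral.integral_nonneg hp.le fun θ _ => sq_nonneg _
  have h4 : ∀ θ, (h θ - a) ^ 2 = h θ ^ 2 + (-(2 * a) * h θ + a ^ 2) := fun θ => by ring
  simp only [h4] at h3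
  rw [intervalIntegral.integral_add h2 ((h1.const_mul _).add (by simp)),
    intervalIntegral.integral_add (h1.const_mul _) (by simp),
    intervalIntegral.integral_const_mul, intervalIntegral.integral_const, sub_zero,
    smul_eq_mul] at h3
  have h5 : ∫ θ in (0 : ℝ)..Real.pi, h θ = a * Real.pi := by rw [ha]; field_simp
  rw [h5] at h3 ⊢
  nlinarith

lemma intervalIntegrable_deviation_sq (m : ℤ) (l t : ℕ) :
    IntervalIntegrable (fun θ => deviation m l t θ ^ 2) volume 0 Real.pi := by
  obtain ⟨K, hK⟩ := (admissible_deviation m l t).exists_bound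
  refine intervalIntegrable_of_bounded (K := K ^ 2)
    ((admissible_deviation m l t).measurable_cotPair.pow_const 2) (fun θ => ?_) _ _
  rw [abs_pow]
  exact pow_le_pow_left₀ (abs_nonneg _) (hK θ) 2

/-- Multiplication by i destroys the vanishing of the imaginary part at θ = 0, so a pole 1/sin(θ/2)
remains. Its square costs 1/h, which the h³ of `imSq_le` repays. -/
lemma abs_cotPair_mul_I_le {θ K : ℝ} {w : ℂ} (hw : ‖w‖ ≤ K) (hθ : 0 < Real.sin (θ / 2)) :
    |cotPair θ (w * Complex.I)| ≤ 2 * K / Real.sin (θ / 2) := by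
  have h : cotPair θ (w * Complex.I)
      = (-w.im * Real.sin (θ / 2) + w.re * Real.cos (θ / 2)) / Real.sin (θ / 2) := by
    simp [cotPair]
    field_simp
  rw [h, abs_div, abs_of_pos hθ]
  gcongr
  refine (abs_add_le _ _).trans ?_
  rw [abs_mul, abs_mul, abs_neg, two_mul]
  have h1 := (Complex.abs_im_le_norm w).trans hw
  have h2 := (Complex.abs_re_le_norm w).trans hw
  exact add_le_add
    ((mul_le_of_le_one_right (abs_nonneg _) (Real.abs_sin_le_one _)).trans h1)
    ((mul_le_of_le_one_right (abs_nonneg _) (Real.abs_cos_le_one _)).trans h2)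

lemma exists_blockMean_deviation_sq_le (m : ℤ) :
    ∃ K, 0 ≤ K ∧ ∀ (l : ℕ) (θ : ℝ), 0 < θ → θ ≤ Real.pi →
    blockMean l (fun t => deviation m l t θ ^ 2)
      ≤ K * (l + 1) * (haverSin θ ^ 2 * decayRate θ ^ l) := by
  obtain ⟨_, K, hK⟩ := admissible_twist m
  -- 83 = 19 + 64, the constants of `reVar_le` and `imSq_le`.
  refine ⟨8 * K ^ 2 * 83, by positivity, fun l θ h0 h1 => ?_⟩
  have hp := Real.pi_pos
  have hs2 : 0 < Real.sin (θ / 2) := Real.sin_pos_of_pos_of_lt_pi (by linarith) (by linarith)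
  have hs : 0 ≤ Real.sin θ := Real.sin_nonneg_of_nonneg_of_le_pi h0.le h1
  have hd : 0 < haverSin θ := by rw [haverSin_eq_sin_sq]; positivity
  have hK0 : 0 ≤ K := (norm_nonneg _).trans (hK θ).1
  have hu := abs_cotPair_le (hK θ).1 (hK θ).2
  have hv := abs_cotPair_mul_I_le (hK θ).1 hs2
  have hu2 : cotPair θ (twist m θ) ^ 2 ≤ 4 * K ^ 2 := by
    have := pow_le_pow_left₀ (abs_nonneg _) hu 2
    rw [sq_abs] at this
    linarith
  have hv2 : cotPair θ (twist m θ * Complex.I) ^ 2 ≤ 4 * K ^ 2 / haverSin θ := by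
    have := pow_le_pow_left₀ (abs_nonneg _) hv 2
    rw [sq_abs, div_pow, ← haverSin_eq_sin_sq, mul_pow] at this
    norm_num at this
    exact this
  have hpt : ∀ t, deviation m l t θ ^ 2 ≤ 8 * K ^ 2 * (rePart θ t - (1 - haverSin θ) ^ l) ^ 2
      + 8 * K ^ 2 / haverSin θ * (imPart θ t * imPart θ t) := by
    intro t
    rw [deviation_eq]
    have e1 := mul_le_mul_of_nonneg_right hu2 (sq_nonneg (rePart θ t - (1 - haverSin θ) ^ l))
    have e2 := mul_le_mul_of_nonneg_right hv2 (mul_self_nonneg (imPart θ t))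
    have e3 := sq_nonneg (cotPair θ (twist m θ) * (rePart θ t - (1 - haverSin θ) ^ l)
      - cotPair θ (twist m θ * Complex.I) * imPart θ t)
    have e4 : 8 * K ^ 2 / haverSin θ = 2 * (4 * K ^ 2 / haverSin θ) := by ring
    rw [e4]
    linarith
  refine (blockMean_mono hpt).trans ?_
  rw [blockMean_add, blockMean_const_mul, blockMean_const_mul]
  change 8 * K ^ 2 * reVar θ l + 8 * K ^ 2 / haverSin θ * imSq θ l ≤ _
  have h3 := mul_le_mul_of_nonneg_left (reVar_le hs l) (by positivity : 0 ≤ 8 * K ^ 2)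
  have h4 := mul_le_mul_of_nonneg_left (imSq_le hs l) (by positivity : 0 ≤ 8 * K ^ 2 / haverSin θ)
  have h5 : 8 * K ^ 2 / haverSin θ * (64 * (l + 1) * haverSin θ ^ 3 * decayRate θ ^ l)
      = 8 * K ^ 2 * (64 * (l + 1) * haverSin θ ^ 2 * decayRate θ ^ l) := by
    field_simp
  rw [h5] at h4
  linarith

/-- Cauchy–Schwarz is applied in θ for each t, and then block mean and integral are exchanged. The
factor l+1 against ∫ h² ρ^l = O(l^{-5/2}) leaves l^{-3/2}. -/
lemma exists_variance_le (m : ℤ) : ∃ K, ∀ l : ℕ, 1 ≤ l →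
    blockMean l (fun t => (tailDens m t - tailMean m l) ^ 2) ≤ K / (l * Real.sqrt l) := by
  obtain ⟨K, hK0, hK⟩ := exists_blockMean_deviation_sq_le m
  refine ⟨1 / (4 * Real.pi) * (K * 2 * (512 * Real.sqrt (16 * Real.pi ^ 3))), fun l hl => ?_⟩
  have hp := Real.pi_pos
  have hl' : (1 : ℝ) ≤ l := by exact_mod_cast hl
  have h1 : ∀ t, 1 ≤ t → (tailDens m t - tailMean m l) ^ 2
      ≤ 1 / (4 * Real.pi) * ∫ θ in (0 : ℝ)..Real.pi, deviation m l t θ ^ 2 := by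
    intro t ht
    rw [tailDens_sub_tailMean m l ht, mul_pow]
    have := sq_integral_le (intervalIntegrable_deviation m l t)
      (intervalIntegrable_deviation_sq m l t)
    calc _ ≤ (1 / (2 * Real.pi)) ^ 2
          * (Real.pi * ∫ θ in (0 : ℝ)..Real.pi, deviation m l t θ ^ 2) := by
          gcongr
      _ = _ := by field_simp; ring
  have h2 : blockMean l (fun t => (tailDens m t - tailMean m l) ^ 2)
      ≤ blockMean l (fun t =>
        1 / (4 * Real.pi) * ∫ θ in (0 : ℝ)..Real.pi, deviation m l t θ ^ 2) := by
    unfold blockMean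
    gcongr with t ht
    exact h1 t (Nat.one_le_two_pow.trans (Finset.mem_Ico.1 ht).1)
  refine h2.trans ?_
  rw [blockMean_const_mul, blockMean_integral l (intervalIntegrable_deviation_sq m l),
    mul_div_assoc]
  gcongr
  have hc1 := continuous_haverSin
  have hc2 := continuous_decayRate
  have hint : IntervalIntegrable (fun θ => blockMean l fun t => deviation m l t θ ^ 2) volume
      0 Real.pi := by
    unfold blockMean
    refine IntervalIntegrable.div_const ?_ _
    have := IntervalIntegrable.sum (μ := volume) (a := 0) (b := Real.pi)
      (Finset.Ico (2 ^ l) (2 ^ (l + 1))) (f := fun t θ => deviation m l t θ ^ 2)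
      fun t _ => intervalIntegrable_deviation_sq m l t
    rwa [show (∑ t ∈ Finset.Ico (2 ^ l) (2 ^ (l + 1)), fun θ => deviation m l t θ ^ 2)
      = fun θ => ∑ t ∈ Finset.Ico (2 ^ l) (2 ^ (l + 1)), deviation m l t θ ^ 2 by
        ext θ; simp [Finset.sum_apply]] at this
  calc ∫ θ in (0 : ℝ)..Real.pi, blockMean l (fun t => deviation m l t θ ^ 2)
      ≤ ∫ θ in (0 : ℝ)..Real.pi, K * (l + 1) * (haverSin θ ^ 2 * decayRate θ ^ l) := by
        refine intervalIntegral.integral_mono_on_of_le_Ioo hp.le hint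
          (Continuous.intervalIntegrable (by fun_prop) _ _) fun θ hθ => ?_
        exact hK l θ hθ.1 hθ.2.le
    _ ≤ K * (l + 1) * (512 / l ^ 2 * (Real.sqrt (16 * Real.pi ^ 3) / Real.sqrt l)) := by
        rw [intervalIntegral.integral_const_mul]
        gcongr
        exact integral_haverSin_sq_mul_decayRate_pow_le hl
    _ ≤ K * (2 * l) * (512 / l ^ 2 * (Real.sqrt (16 * Real.pi ^ 3) / Real.sqrt l)) := by
        gcongr
        linarith
    _ = _ := by field_simp

/-! ### Asymptotics of the block mean, and the second moment. -/

lemma sin_mul_cot_half {θ : ℝ} (h : Real.sin (θ / 2) ≠ 0) :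
    Real.sin θ * (Real.cos (θ / 2) / Real.sin (θ / 2)) = 1 + Real.cos θ := by
  have h1 := Real.sin_two_mul (θ / 2)
  have h2 := Real.cos_two_mul (θ / 2)
  rw [show 2 * (θ / 2) = θ by ring] at h1 h2
  rw [h1, h2]
  field_simp
  ring

/-- The imaginary part of γ_1 has no first-order term at θ = 0, so the cotangent contributes nothing
in the limit and σ = 1. In the exact error, |1 - 2cos θ| ≤ 3 and 5 - 4cos θ ≥ 1 give 6(1 - cos θ) =
12h. -/
lemma abs_cotPair_twist_zero_sub_le {θ : ℝ} (h : Real.sin (θ / 2) ≠ 0) :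
    |cotPair θ (twist 0 θ) - 1| ≤ 12 * haverSin θ := by
  have h5 := five_sub_pos θ
  have h6 : (5 - 4 * Real.cos θ) ≠ 0 := by linarith
  have hs := Real.sin_sq_add_cos_sq θ
  have e : cotPair θ (twist 0 θ) - 1
      = -2 * (1 - Real.cos θ) * (1 - 2 * Real.cos θ) / (5 - 4 * Real.cos θ) := by
    have hc := sin_mul_cot_half h
    rw [twist, neg_zero, phase_zero, mul_one, charFnOne, cotPair_ofReal_mul]
    simp only [cotPair, Complex.mul_re, Complex.mul_im, Complex.sub_re, Complex.sub_im, phase_re,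
      phase_im, Complex.re_ofNat, Complex.im_ofNat, Int.cast_one, one_mul]
    rw [eq_div_iff h6, sub_mul, mul_comm _ (5 - 4 * Real.cos θ), mul_inv_cancel_left₀ h6]
    linear_combination (2 - 2 * Real.cos θ) * hc + hs
  rw [e, abs_div, abs_of_pos (by linarith : 0 < 5 - 4 * Real.cos θ)]
  refine (div_le_self (abs_nonneg _) h5).trans ?_
  have h1 := Real.cos_le_one θ
  have h2 := Real.neg_one_le_cos θ
  rw [haverSin, abs_le]
  constructor <;> nlinarith

/-- The extra factor e^{-iθ} has imaginary part about -θ, while cot(θ/2) is about 2/θ; this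
contributes -2 and changes the limit from 1 to σ = -1. -/
lemma abs_cotPair_twist_one_sub_le {θ : ℝ} (h : Real.sin (θ / 2) ≠ 0) :
    |cotPair θ (twist 1 θ) - (-1)| ≤ 12 * haverSin θ := by
  have h5 := five_sub_pos θ
  have h6 : (5 - 4 * Real.cos θ) ≠ 0 := by linarith
  have hph : phase θ 1 * phase θ (-1) = 1 := by rw [← phase_add]; simp [phase_zero]
  have e : cotPair θ (twist 1 θ) - (-1) = 6 * (1 - Real.cos θ) / (5 - 4 * Real.cos θ) := by
    have hc := sin_mul_cot_half h
    have ht : twist 1 θ = (((5 - 4 * Real.cos θ)⁻¹ : ℝ) : ℂ) * (2 - phase θ 1) := by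
      rw [twist, charFnOne]
      linear_combination (((5 - 4 * Real.cos θ)⁻¹ : ℝ) : ℂ) * (2 - phase θ 1) * hph
    rw [ht, cotPair_ofReal_mul]
    simp only [cotPair, Complex.sub_re, Complex.sub_im, phase_re,
      phase_im, Complex.re_ofNat, Complex.im_ofNat, Int.cast_one, one_mul]
    rw [eq_div_iff h6, sub_mul, mul_comm _ (5 - 4 * Real.cos θ), mul_inv_cancel_left₀ h6]
    linear_combination -hc
  have h1 := Real.cos_le_one θ
  rw [e, abs_div, abs_of_pos (by linarith : 0 < 5 - 4 * Real.cos θ)]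
  refine (div_le_self (abs_nonneg _) h5).trans ?_
  rw [haverSin, abs_of_nonneg (by linarith)]
  linarith

lemma exists_abs_tailMean_sub_le {m : ℤ} {σ : ℝ} (hσ : ∀ θ, Real.sin (θ / 2) ≠ 0 →
    |cotPair θ (twist m θ) - σ| ≤ 12 * haverSin θ) : ∃ K, ∀ l : ℕ, 1 ≤ l →
    |tailMean m l - (1 / 2 + σ / 2 * centralMass l)| ≤ K / (l * Real.sqrt l) := by
  refine ⟨1 / (2 * Real.pi) * (12 * (2 * Real.sqrt (16 * Real.pi ^ 3))), fun l hl => ?_⟩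
  have hp := Real.pi_pos
  have hl' : (1 : ℝ) ≤ l := by exact_mod_cast hl
  have hc1 := continuous_haverSin
  have hI := (admissible_mean m l).intervalIntegrable 0 Real.pi
  have hJ : IntervalIntegrable (fun θ => (1 - haverSin θ) ^ l) volume 0 Real.pi :=
    (continuous_one_sub_haverSin_pow l).intervalIntegrable _ _
  have e : tailMean m l - (1 / 2 + σ / 2 * centralMass l) = 1 / (2 * Real.pi)
      * ∫ θ in (0 : ℝ)..Real.pi, (1 - haverSin θ) ^ l * (cotPair θ (twist m θ) - σ) := by
    have h : ∀ θ, (1 - haverSin θ) ^ l * (cotPair θ (twist m θ) - σ)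
        = cotPair θ ((((1 - haverSin θ) ^ l : ℝ) : ℂ) * twist m θ)
          - σ * (1 - haverSin θ) ^ l := by
      intro θ
      rw [cotPair_ofReal_mul]
      ring
    simp only [h]
    rw [intervalIntegral.integral_sub hI (hJ.const_mul σ), intervalIntegral.integral_const_mul,
      tailMean, tailFunctional, centralMass]
    field_simp
    ring
  rw [e, abs_mul, abs_of_pos (by positivity : 0 < 1 / (2 * Real.pi)), mul_div_assoc]
  gcongr
  calc |∫ θ in (0 : ℝ)..Real.pi, (1 - haverSin θ) ^ l * (cotPair θ (twist m θ) - σ)|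
      ≤ ∫ θ in (0 : ℝ)..Real.pi, 12 * (haverSin θ * (1 - haverSin θ) ^ l) := by
        rw [← Real.norm_eq_abs]
        refine intervalIntegral.norm_integral_le_of_norm_le hp.le
          (Eventually.of_forall fun θ hθ => ?_) (Continuous.intervalIntegrable (by fun_prop) _ _)
        have hs2 : Real.sin (θ / 2) ≠ 0 :=
          (Real.sin_pos_of_pos_of_lt_pi (by linarith [hθ.1]) (by linarith [hθ.2])).ne'
        have h0 : 0 ≤ (1 - haverSin θ) ^ l := pow_nonneg (by linarith [haverSin_le_one θ]) l
        rw [Real.norm_eq_abs, abs_mul, abs_of_nonneg h0]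
        have := mul_le_mul_of_nonneg_left (hσ θ hs2) h0
        linarith
    _ ≤ 12 * (2 / l * (Real.sqrt (16 * Real.pi ^ 3) / Real.sqrt l)) := by
        rw [intervalIntegral.integral_const_mul]
        gcongr
        exact integral_haverSin_mul_one_sub_pow_le hl
    _ = _ := by field_simp

lemma blockMean_sq (m : ℤ) (l : ℕ) : blockMean l (fun t => tailDens m t ^ 2)
    = tailMean m l ^ 2 + blockMean l (fun t => (tailDens m t - tailMean m l) ^ 2) := by
  have h : blockMean l (fun t => tailDens m t ^ 2) = blockMean l fun t =>
      tailMean m l ^ 2 + ((tailDens m t - tailMean m l) ^ 2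
        + 2 * tailMean m l * (tailDens m t - tailMean m l)) :=
    blockMean_congr fun t _ => by ring
  rw [h, blockMean_add, blockMean_add, blockMean_const, blockMean_const_mul,
    blockMean_tailDens_sub]
  ring

lemma exists_abs_secondMoment_sub_le {m : ℤ} {σ : ℝ} (hσ1 : σ ^ 2 = 1)
    (hσ : ∀ θ, Real.sin (θ / 2) ≠ 0 → |cotPair θ (twist m θ) - σ| ≤ 12 * haverSin θ) :
    ∃ K, ∀ l : ℕ, 1 ≤ l → |blockMean l (fun t => tailDens m t ^ 2)
      - (1 / 4 + σ / 2 * (1 / Real.sqrt (Real.pi * l)) + 1 / (4 * (Real.pi * l)))|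
      ≤ K / (l * Real.sqrt l) := by
  obtain ⟨K₁, hK₁⟩ := exists_abs_tailMean_sub_le hσ
  obtain ⟨K₂, hK₂⟩ := exists_variance_le m
  refine ⟨(K₁ + 1) * (2 + (K₁ + 1)) + K₂, fun l hl => ?_⟩
  have hl' : (1 : ℝ) ≤ l := by exact_mod_cast hl
  have h1 := hK₁ l hl
  have h2 := hK₂ l hl
  have h3 := abs_centralMass_sub_le hl
  have hV : 0 ≤ blockMean l (fun t => (tailDens m t - tailMean m l) ^ 2) :=
    blockMean_nonneg fun _ => sq_nonneg _
  have hpos : 0 < (l : ℝ) * Real.sqrt l := by positivity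
  have hε : 1 / ((l : ℝ) * Real.sqrt l) ≤ 1 := by
    rw [div_le_one hpos]
    nlinarith [Real.one_le_sqrt.2 hl']
  have hε0 : 0 < 1 / ((l : ℝ) * Real.sqrt l) := by positivity
  rw [div_eq_mul_one_div K₁] at h1
  rw [div_eq_mul_one_div K₂] at h2
  rw [div_eq_mul_one_div (_ + K₂)]
  set ε := 1 / ((l : ℝ) * Real.sqrt l)
  have hσabs : |σ / 2| = 1 / 2 := by
    rw [← sq_abs] at hσ1
    rw [abs_div, (pow_eq_one_iff_of_nonneg (abs_nonneg _) two_ne_zero).1 hσ1, abs_two]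
  have hr2 : (1 / Real.sqrt (Real.pi * l)) ^ 2 = 1 / (Real.pi * l) := by
    rw [div_pow, Real.sq_sqrt (by positivity), one_pow]
  have hr1 : 1 / Real.sqrt (Real.pi * l) ≤ 1 := by
    rw [div_le_one (by positivity)]
    exact Real.one_le_sqrt.2 (by nlinarith [Real.pi_gt_three])
  have hr0 : 0 ≤ 1 / Real.sqrt (Real.pi * l) := by positivity
  set r := 1 / Real.sqrt (Real.pi * l)
  have hK0 : 0 ≤ K₁ := by
    by_contra hneg
    have := mul_neg_of_neg_of_pos (not_le.1 hneg) hε0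
    linarith [abs_nonneg (tailMean m l - (1 / 2 + σ / 2 * centralMass l))]
  set a := 1 / 2 + σ / 2 * r with ha
  have h4 : |tailMean m l - a| ≤ (K₁ + 1) * ε := by
    have e : tailMean m l - a = (tailMean m l - (1 / 2 + σ / 2 * centralMass l))
        + σ / 2 * (centralMass l - r) := by rw [ha]; ring
    rw [e]
    refine (abs_add_le _ _).trans ?_
    rw [abs_mul, hσabs]
    linarith [abs_nonneg (centralMass l - r)]
  have ha1 : |a| ≤ 1 := by
    rw [ha]
    refine (abs_add_le _ _).trans ?_
    rw [abs_mul, hσabs, abs_of_nonneg hr0, abs_of_pos (by norm_num)]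
    linarith
  have h5 : |tailMean m l + a| ≤ 2 + (K₁ + 1) := by
    have e : tailMean m l + a = (tailMean m l - a) + 2 * a := by ring
    rw [e]
    refine (abs_add_le _ _).trans ?_
    rw [abs_mul, abs_two]
    nlinarith
  -- As σ² = 1 and r² = 1/(πl), the three terms of the expansion form the perfect square of the
  -- approximate mean a.
  have ea : 1 / 4 + σ / 2 * r + 1 / (4 * (Real.pi * l)) = a ^ 2 := by
    rw [show 1 / (4 * (Real.pi * (l : ℝ))) = 1 / 4 * (1 / (Real.pi * l)) by field_simp, ← hr2, ha]
    linear_combination (-(r ^ 2) / 4) * hσ1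
  rw [ea, blockMean_sq]
  have e : tailMean m l ^ 2 + blockMean l (fun t => (tailDens m t - tailMean m l) ^ 2) - a ^ 2
      = (tailMean m l - a) * (tailMean m l + a)
        + blockMean l (fun t => (tailDens m t - tailMean m l) ^ 2) := by ring
  rw [e]
  refine (abs_add_le _ _).trans ?_
  rw [abs_mul, abs_of_nonneg hV, add_mul]
  refine add_le_add ?_ h2
  calc |tailMean m l - a| * |tailMean m l + a| ≤ ((K₁ + 1) * ε) * (2 + (K₁ + 1)) := by gcongr
    _ = _ := by ring

lemma isBigO_coeff3_F {m : ℤ} {σ : ℝ} {j : ℕ → ℕ} (hj : ∀ n : ℕ, (n : ℤ) + 1 - j n = m)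
    (hσ1 : σ ^ 2 = 1)
    (hσ : ∀ θ, Real.sin (θ / 2) ≠ 0 → |cotPair θ (twist m θ) - σ| ≤ 12 * haverSin θ) :
    (fun n : ℕ => coeff3 n (j n) (j n) F / (8 : ℝ) ^ n
        - (1 / 4 + σ * (1 / (2 * Real.sqrt Real.pi) * (1 / Real.sqrt (n : ℝ)))
          + 1 / (4 * Real.pi) * (1 / (n : ℝ))))
      =O[atTop] (fun n : ℕ => (n : ℝ) ^ (-(3 / 2) : ℝ)) := by
  obtain ⟨K, hK⟩ := exists_abs_secondMoment_sub_le hσ1 hσ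
  refine IsBigO.of_bound K ?_
  filter_upwards [eventually_ge_atTop 1] with n hn
  have hp := Real.pi_pos
  have hn' : (0 : ℝ) < n := by exact_mod_cast hn
  have hpow : (n : ℝ) ^ (-(3 / 2) : ℝ) = 1 / (n * Real.sqrt n) := by
    rw [Real.rpow_neg hn'.le, Real.sqrt_eq_rpow, ← Real.rpow_one_add' hn'.le (by norm_num),
      one_div]
    norm_num
  have h := hK n hn
  rw [hpow, Real.norm_eq_abs, Real.norm_of_nonneg (by positivity), ← div_eq_mul_one_div K,
    coeff3_F_div n (j n) m (hj n)]
  convert h using 2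
  rw [Real.sqrt_mul hp.le, blockMean]
  field_simp

end Cusick

end

theorem mainTheorem4 :
    -- asymptotic expansions of the two diagonals of `F`
    ((fun n : ℕ => Cusick.coeff3 n (n + 1) (n + 1) Cusick.F / (8 : ℝ) ^ n
        - (1 / 4 + 1 / (2 * Real.sqrt Real.pi) * (1 / Real.sqrt (n : ℝ))
          + 1 / (4 * Real.pi) * (1 / (n : ℝ))))
      =O[atTop] (fun n : ℕ => (n : ℝ) ^ (-(3 / 2) : ℝ))) ∧
    ((fun n : ℕ => Cusick.coeff3 n n n Cusick.F / (8 : ℝ) ^ n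
        - (1 / 4 - 1 / (2 * Real.sqrt Real.pi) * (1 / Real.sqrt (n : ℝ))
          + 1 / (4 * Real.pi) * (1 / (n : ℝ))))
      =O[atTop] (fun n : ℕ => (n : ℝ) ^ (-(3 / 2) : ℝ))) ∧
    -- all the densities involved exist
    (∀ (k : ℤ) (t : ℕ), Cusick.HasDensity (Cusick.B k t) (Cusick.δ k t)) ∧
    (∀ t : ℕ, Cusick.HasDensity {n | Cusick.s n ≤ Cusick.s (n + t)} (Cusick.c t)) ∧
    (∀ t : ℕ, Cusick.HasDensity {n | Cusick.s n < Cusick.s (n + t)} (Cusick.cTilde t)) ∧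
    -- `A` is the generating function of the correlations of the densities `δ(k,t)`
    (∀ l j k : ℕ, Cusick.coeff3 l j k Cusick.A =
      (4 : ℝ) ^ l * ∑ t ∈ Finset.Ico (2 ^ l) (2 ^ (l + 1)),
        Cusick.δ ((l : ℤ) + 1 - (j : ℤ)) t * Cusick.δ ((l : ℤ) + 1 - (k : ℤ)) t) ∧
    -- the diagonals of `F` are the second moments of `c_t` and `c̃_t` over dyadic blocks
    (∀ l : ℕ, (∑ t ∈ Finset.Ico (2 ^ l) (2 ^ (l + 1)), Cusick.c t ^ 2) / (2 : ℝ) ^ l =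
      Cusick.coeff3 l (l + 1) (l + 1) Cusick.F / (8 : ℝ) ^ l) ∧
    (∀ l : ℕ, (∑ t ∈ Finset.Ico (2 ^ l) (2 ^ (l + 1)), Cusick.cTilde t ^ 2) / (2 : ℝ) ^ l =
      Cusick.coeff3 l l l Cusick.F / (8 : ℝ) ^ l) := by
  refine ⟨?_, ?_, Cusick.hasDensity_B, fun t => ?_, fun t => ?_, Cusick.coeff3_A, fun l => ?_,
    fun l => ?_⟩
  · simpa only [one_mul] using Cusick.isBigO_coeff3_F (m := 0) (σ := 1) (j := fun n => n + 1)
      (fun n => by push_cast; ring) (by norm_num)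
      fun θ hθ => Cusick.abs_cotPair_twist_zero_sub_le hθ
  · simpa only [neg_one_mul, ← sub_eq_add_neg] using
      Cusick.isBigO_coeff3_F (m := 1) (σ := -1) (j := fun n => n)
        (fun n => by ring) (by norm_num) fun θ hθ => Cusick.abs_cotPair_twist_one_sub_le hθ
  · rw [Cusick.c_eq_tailDens, Cusick.setOf_le_eq_tail]
    exact Cusick.hasDensity_tail 0 t
  · rw [Cusick.cTilde_eq_tailDens, Cusick.setOf_lt_eq_tail]
    exact Cusick.hasDensity_tail 1 t
  · simp only [Cusick.c_eq_tailDens]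
    exact (Cusick.coeff3_F_div l (l + 1) 0 (by push_cast; ring)).symm
  · simp only [Cusick.cTilde_eq_tailDens]
    exact (Cusick.coeff3_F_div l l 1 (by ring)).symm
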